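/- Let $q\in\mathbb{C}^*$ be not a root of unity, fix a square root $q^{1/2}$ of $q$, and let $\dot z\in\mathbb{C}^*$. Let $U_q(\mathfrak{s})$ be the quantum Schrödinger algebra: the associative $\mathbb{C}$-algebra generated by $E,F,K^{\pm1},X,Y,Z$ with $Z$ central and relations $$[E,F]=\tfrac{K-K^{-1}}{q-q^{-1}},\quad KEK^{-1}=q^2E,\quad KFK^{-1}=q^{-2}F,\quad KXK^{-1}=qX,\quad KYK^{-1}=q^{-1}Y,$$ $$qYX-XY=Z,\quad EX=qXE,\quad EY=X+q^{-1}YE,\quad FX=YK^{-1}+XF,\quad FY=YF,$$ let $U_q(\mathfrak{sl}_2)$ be the quantum group on $E,F,K^{\pm1}$ (with those of the above relations that involve only $E,F,K^{\pm1}$), and let $H_q\subset U_q(\mathfrak{s})$ be the subalgebra generated by $X,Y,Z$. Let $\widetilde B_{\dot z}$ be the $U_q(\mathfrak{s})$-module with underlying $H_q$-module $H_q/(H_q(Z-\dot z)+H_qX)$, with basis $v_i$ = the class of $Y^i$ ($i\ge 0$), and with $$Kv_i=q^{-\frac12-i}v_i,\qquad Fv_i=\frac{q^{1/2}}{\dot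 z(q+1)}v_{i+2},\qquad Ev_i=\frac{-\dot z(q^i-1)(q^{i-1}-1)}{q^{i-2}(q^2-1)(q-1)}v_{i-2}.$$ For a $U_q(\mathfrak{sl}_2)$-module $N$ let $\widetilde N$ be the $U_q(\mathfrak{s})$-module $N$ on which $X,Y,Z$ act by zero. Let $U_q(\mathfrak{s})$ act on $\widetilde N\otimes_{\mathbb{C}}\widetilde B_{\dot z}$ through the algebra homomorphism $\Delta:U_q(\mathfrak{s})\to U_q(\mathfrak{s})\otimes U_q(\mathfrak{s})$ with $$\Delta(E)=1\otimes E+E\otimes K,\quad \Delta(F)=K^{-1}\otimes F+F\otimes 1,\quad \Delta(K^{\pm1})=K^{\pm1}\otimes K^{\pm1},\quad \Delta(u)=1\otimes u\ \ (u=X,Y,Z).$$ Category $\mathcal{O}$ consists of the finitely generated $U_q(\mathfrak{s})$-modules which are direct sums of the eigenspaces of $K$ for nonzero eigenvalues and on which the subalgebra generated by $E$ and $X$ acts locally finitely; $\mathcal{O}[\dot z]$ is its full subcategory of modules annihilated by some power of $Z-\dot z$. Category $\mathcal{O}^{(\mathfrak{sl}_2)}$ is defined in the same way for $U_q(\mathfrak{sl}_2)$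 and the subalgebra generated by $E$. **Proposition.** Let $V$ be a module in $\mathcal{O}[\dot z]$ with central charge $\dot z\neq 0$, that is, $Z$ acts on $V$ as the scalar $\dot z$. Then there is a $U_q(\mathfrak{sl}_2)$-module $N$, belonging to $\mathcal{O}^{(\mathfrak{sl}_2)}$, such that $V\cong\widetilde N\otimes\widetilde B_{\dot z}$ as $U_q(\mathfrak{s})$-modules. -/

import Mathlib

universe u

open scoped TensorProduct

noncomputable section

namespace QSchr

/-! ### The algebras `U_q(s)` and `U_q(sl_2)` by generators and relations -/

/-- Generators of the quantum Schrodinger algebra; `Ki` stands for the inverse of `K`. -/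
inductive SGen
  | E | F | K | Ki | X | Y | Z

/-- The defining relations of the quantum Schrodinger algebra `U_q(s)`. -/
inductive SRel (q : ℂ) : FreeAlgebra ℂ SGen → FreeAlgebra ℂ SGen → Prop
  | K_Ki : SRel q (.ι ℂ .K * .ι ℂ .Ki) 1
  | Ki_K : SRel q (.ι ℂ .Ki * .ι ℂ .K) 1
  | E_F : SRel q (.ι ℂ .E * .ι ℂ .F - .ι ℂ .F * .ι ℂ .E)
      ((q - q⁻¹)⁻¹ • (.ι ℂ .K - .ι ℂ .Ki))
  | K_X : SRel q (.ι ℂ .K * .ι ℂ .X * .ι ℂ .Ki) (q • .ι ℂ .X)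
  | K_E : SRel q (.ι ℂ .K * .ι ℂ .E * .ι ℂ .Ki) (q ^ 2 • .ι ℂ .E)
  | K_F : SRel q (.ι ℂ .K * .ι ℂ .F * .ι ℂ .Ki) ((q ^ 2)⁻¹ • .ι ℂ .F)
  | K_Y : SRel q (.ι ℂ .K * .ι ℂ .Y * .ι ℂ .Ki) (q⁻¹ • .ι ℂ .Y)
  | Y_X : SRel q (q • (.ι ℂ .Y * .ι ℂ .X) - .ι ℂ .X * .ι ℂ .Y) (.ι ℂ .Z)
  | E_X : SRel q (.ι ℂ .E * .ι ℂ .X) (q • (.ι ℂ .X * .ι ℂ .E))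
  | E_Y : SRel q (.ι ℂ .E * .ι ℂ .Y) (.ι ℂ .X + q⁻¹ • (.ι ℂ .Y * .ι ℂ .E))
  | F_X : SRel q (.ι ℂ .F * .ι ℂ .X) (.ι ℂ .Y * .ι ℂ .Ki + .ι ℂ .X * .ι ℂ .F)
  | F_Y : SRel q (.ι ℂ .F * .ι ℂ .Y) (.ι ℂ .Y * .ι ℂ .F)
  | Z_central (g : SGen) : SRel q (.ι ℂ .Z * .ι ℂ g) (.ι ℂ g * .ι ℂ .Z)

/-- The quantum Schrodinger algebra `U_q(s)`. -/
def Us (q : ℂ) : Type := RingQuot (SRel q)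

instance (q : ℂ) : Ring (Us q) := inferInstanceAs (Ring (RingQuot (SRel q)))
instance (q : ℂ) : Algebra ℂ (Us q) := inferInstanceAs (Algebra ℂ (RingQuot (SRel q)))

/-- The image of a generator in `U_q(s)`. -/
def Us.gen (q : ℂ) (g : SGen) : Us q := RingQuot.mkAlgHom ℂ (SRel q) (.ι ℂ g)

/-- Generators of the quantum group `U_q(sl_2)`. -/
inductive LGen
  | E | F | K | Ki

/-- The defining relations of the quantum group `U_q(sl_2)`. -/
inductive LRel (q : ℂ) : FreeAlgebra ℂ LGen → FreeAlgebra ℂ LGen → Prop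
  | K_Ki : LRel q (.ι ℂ .K * .ι ℂ .Ki) 1
  | Ki_K : LRel q (.ι ℂ .Ki * .ι ℂ .K) 1
  | E_F : LRel q (.ι ℂ .E * .ι ℂ .F - .ι ℂ .F * .ι ℂ .E)
      ((q - q⁻¹)⁻¹ • (.ι ℂ .K - .ι ℂ .Ki))
  | K_E : LRel q (.ι ℂ .K * .ι ℂ .E * .ι ℂ .Ki) (q ^ 2 • .ι ℂ .E)
  | K_F : LRel q (.ι ℂ .K * .ι ℂ .F * .ι ℂ .Ki) ((q ^ 2)⁻¹ • .ι ℂ .F)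

/-- The quantum group `U_q(sl_2)`. -/
def Ul (q : ℂ) : Type := RingQuot (LRel q)

instance (q : ℂ) : Ring (Ul q) := inferInstanceAs (Ring (RingQuot (LRel q)))
instance (q : ℂ) : Algebra ℂ (Ul q) := inferInstanceAs (Algebra ℂ (RingQuot (LRel q)))

/-- The image of a generator in `U_q(sl_2)`. -/
def Ul.gen (q : ℂ) (g : LGen) : Ul q := RingQuot.mkAlgHom ℂ (LRel q) (.ι ℂ g)

/-- Data for an algebra homomorphism out of `U_q(s)`: images of the generators which
satisfy the defining relations. -/
structure SData (q : ℂ) {A : Type*} [Ring A] [Algebra ℂ A] (f : SGen → A) : Prop where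
  K_Ki : f .K * f .Ki = 1
  Ki_K : f .Ki * f .K = 1
  E_F : f .E * f .F - f .F * f .E = (q - q⁻¹)⁻¹ • (f .K - f .Ki)
  K_X : f .K * f .X = q • (f .X * f .K)
  K_E : f .K * f .E = q ^ 2 • (f .E * f .K)
  K_F : f .K * f .F = (q ^ 2)⁻¹ • (f .F * f .K)
  K_Y : f .K * f .Y = q⁻¹ • (f .Y * f .K)
  Y_X : q • (f .Y * f .X) - f .X * f .Y = f .Z
  E_X : f .E * f .X = q • (f .X * f .E)
  E_Y : f .E * f .Y = f .X + q⁻¹ • (f .Y * f .E)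
  F_X : f .F * f .X = f .Y * f .Ki + f .X * f .F
  F_Y : f .F * f .Y = f .Y * f .F
  Z_central : ∀ g, f .Z * f g = f g * f .Z

/-- The universal property of `U_q(s)`. -/
def Us.lift {q : ℂ} {A : Type*} [Ring A] [Algebra ℂ A] (f : SGen → A) (h : SData q f) :
    Us q →ₐ[ℂ] A :=
  RingQuot.liftAlgHom ℂ ⟨FreeAlgebra.lift ℂ f, by
    intro x y hxy
    cases hxy with
    | K_Ki => simpa using h.K_Ki
    | Ki_K => simpa using h.Ki_K
    | E_F => simpa using h.E_F
    | K_X =>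
      simp only [map_mul, map_smul, FreeAlgebra.lift_ι_apply, h.K_X, smul_mul_assoc]
      rw [mul_assoc, h.K_Ki, mul_one]
    | K_E =>
      simp only [map_mul, map_smul, FreeAlgebra.lift_ι_apply, h.K_E, smul_mul_assoc]
      rw [mul_assoc, h.K_Ki, mul_one]
    | K_F =>
      simp only [map_mul, map_smul, FreeAlgebra.lift_ι_apply, h.K_F, smul_mul_assoc]
      rw [mul_assoc, h.K_Ki, mul_one]
    | K_Y =>
      simp only [map_mul, map_smul, FreeAlgebra.lift_ι_apply, h.K_Y, smul_mul_assoc]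
      rw [mul_assoc, h.K_Ki, mul_one]
    | Y_X => simpa using h.Y_X
    | E_X => simpa using h.E_X
    | E_Y => simpa using h.E_Y
    | F_X => simpa using h.F_X
    | F_Y => simpa using h.F_Y
    | Z_central g => simpa using h.Z_central g⟩

@[simp] theorem Us.lift_gen {q : ℂ} {A : Type*} [Ring A] [Algebra ℂ A] (f : SGen → A)
    (h : SData q f) (g : SGen) : Us.lift f h (Us.gen q g) = f g := by
  unfold Us.lift Us.gen
  erw [RingQuot.liftAlgHom_mkAlgHom_apply]
  simp

theorem Us.mk_eq {q : ℂ} {x y : FreeAlgebra ℂ SGen} (h : SRel q x y) :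
    (RingQuot.mkAlgHom ℂ (SRel q) x : Us q) = RingQuot.mkAlgHom ℂ (SRel q) y :=
  RingQuot.mkAlgHom_rel ℂ h

theorem Ul.mk_eq {q : ℂ} {x y : FreeAlgebra ℂ LGen} (h : LRel q x y) :
    (RingQuot.mkAlgHom ℂ (LRel q) x : Ul q) = RingQuot.mkAlgHom ℂ (LRel q) y :=
  RingQuot.mkAlgHom_rel ℂ h

/-- If `K a Ki = c a` and `Ki K = 1`, then `K a = c (a K)`. -/
theorem conj_rel {A : Type*} [Ring A] [Algebra ℂ A] {k ki a : A} {c : ℂ}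
    (hk : ki * k = 1) (h : k * a * ki = c • a) : k * a = c • (a * k) := by
  calc k * a = k * a * ki * k := by rw [mul_assoc (k * a), hk, mul_one]
    _ = c • (a * k) := by rw [h, smul_mul_assoc]

theorem Us.data (q : ℂ) : SData q (Us.gen q) := by
  have hk : Us.gen q .Ki * Us.gen q .K = 1 := by
    have := Us.mk_eq (SRel.Ki_K (q := q)); rw [map_mul, map_one] at this; exact this
  constructor
  · have := Us.mk_eq (SRel.K_Ki (q := q)); rw [map_mul, map_one] at this; exact this
  · exact hk
  · have := Us.mk_eq (SRel.E_F (q := q))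
    rw [map_sub, map_mul, map_mul, map_smul, map_sub] at this; exact this
  · have := Us.mk_eq (SRel.K_X (q := q))
    rw [map_mul, map_mul, map_smul] at this; exact conj_rel hk this
  · have := Us.mk_eq (SRel.K_E (q := q))
    rw [map_mul, map_mul, map_smul] at this; exact conj_rel hk this
  · have := Us.mk_eq (SRel.K_F (q := q))
    rw [map_mul, map_mul, map_smul] at this; exact conj_rel hk this
  · have := Us.mk_eq (SRel.K_Y (q := q))
    rw [map_mul, map_mul, map_smul] at this; exact conj_rel hk this
  · have := Us.mk_eq (SRel.Y_X (q := q))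
    rw [map_sub, map_smul, map_mul, map_mul] at this; exact this
  · have := Us.mk_eq (SRel.E_X (q := q))
    rw [map_smul, map_mul, map_mul] at this; exact this
  · have := Us.mk_eq (SRel.E_Y (q := q))
    rw [map_add, map_smul, map_mul, map_mul] at this; exact this
  · have := Us.mk_eq (SRel.F_X (q := q))
    rw [map_add, map_mul, map_mul, map_mul] at this; exact this
  · have := Us.mk_eq (SRel.F_Y (q := q))
    rw [map_mul, map_mul] at this; exact this
  · intro g
    have := Us.mk_eq (SRel.Z_central (q := q) g)
    rw [map_mul, map_mul] at this; exact this

/-! ### Category `O` -/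

/-- Membership in category `O` for a module `V` over a complex algebra `A` with a
distinguished element `K` (whose eigenspaces are the weight spaces) and a distinguished
subalgebra `P` (the positive part): `V` is finitely generated, is the direct sum of its
weight spaces `V_l`, `l` a nonzero complex number, and `P v` is finite dimensional for every
`v` in `V`. -/
structure InCatO (A : Type*) [Ring A] [Algebra ℂ A] (K : A) (P : Subalgebra ℂ A)
    (V : Type*) [AddCommGroup V] [Module ℂ V] [Module A V] [IsScalarTower ℂ A V] : Prop where
  finite : Module.Finite A V
  weight : DirectSum.IsInternal fun l : ℂˣ =>
    Module.End.eigenspace (Algebra.lsmul ℂ ℂ V K) (l : ℂ)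
  locallyFinite : ∀ v : V, FiniteDimensional ℂ
    (Submodule.span ℂ ((fun u : A => u • v) '' (P : Set A)))

/-- Category `O` of `U_q(s)`; the positive part is the subalgebra generated by `E` and `X`. -/
def InO (q : ℂ) (V : Type*) [AddCommGroup V] [Module ℂ V] [Module (Us q) V]
    [IsScalarTower ℂ (Us q) V] : Prop :=
  InCatO (Us q) (Us.gen q .K) (Algebra.adjoin ℂ {Us.gen q .E, Us.gen q .X}) V

/-- The BGG category `O` of `U_q(sl_2)`; the positive part is the subalgebra generated
by `E`. -/
def InOsl2 (q : ℂ) (N : Type*) [AddCommGroup N] [Module ℂ N] [Module (Ul q) N]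
    [IsScalarTower ℂ (Ul q) N] : Prop :=
  InCatO (Ul q) (Ul.gen q .K) (Algebra.adjoin ℂ {Ul.gen q .E}) N

/-- The full subcategory `O[z]`: modules in `O` annihilated by some power of `Z - z`. -/
def InOz (q z : ℂ) (V : Type*) [AddCommGroup V] [Module ℂ V] [Module (Us q) V]
    [IsScalarTower ℂ (Us q) V] : Prop :=
  InO q V ∧ ∃ n : ℕ, ∀ v : V, (Us.gen q .Z - algebraMap ℂ (Us q) z) ^ n • v = 0

/-- `V` has central charge `z`: the central element `Z` acts on `V` as the scalar `z`. -/
def HasCentralCharge (q z : ℂ) (V : Type*) [AddCommGroup V] [Module ℂ V]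
    [Module (Us q) V] : Prop :=
  ∀ v : V, Us.gen q .Z • v = z • v

/-! ### The tensor product of `U_q(s)`-modules -/

/-- Values of `Δ` on the generators. -/
def comulFun (q : ℂ) : SGen → Us q ⊗[ℂ] Us q
  | .E => 1 ⊗ₜ Us.gen q .E + Us.gen q .E ⊗ₜ Us.gen q .K
  | .F => Us.gen q .Ki ⊗ₜ Us.gen q .F + Us.gen q .F ⊗ₜ 1
  | .K => Us.gen q .K ⊗ₜ Us.gen q .K
  | .Ki => Us.gen q .Ki ⊗ₜ Us.gen q .Ki
  | .X => 1 ⊗ₜ Us.gen q .X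
  | .Y => 1 ⊗ₜ Us.gen q .Y
  | .Z => 1 ⊗ₜ Us.gen q .Z

theorem comulFun_data {q : ℂ} (hq : q ≠ 0) : SData q (comulFun q) := by
  have h := Us.data q
  have hEKi : Us.gen q .E * Us.gen q .Ki = q ^ 2 • (Us.gen q .Ki * Us.gen q .E) := by
    calc Us.gen q .E * Us.gen q .Ki
        = Us.gen q .Ki * (Us.gen q .K * Us.gen q .E) * Us.gen q .Ki := by
          rw [← mul_assoc, h.Ki_K, one_mul]
      _ = _ := by
          rw [h.K_E, mul_smul_comm, smul_mul_assoc, mul_assoc, mul_assoc, h.K_Ki, mul_one]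
  constructor
  · simp [comulFun, h.K_Ki, Algebra.TensorProduct.one_def]
  · simp [comulFun, h.Ki_K, Algebra.TensorProduct.one_def]
  · have hq2 : q ^ 2 ≠ 0 := pow_ne_zero _ hq
    simp only [comulFun, add_mul, mul_add, Algebra.TensorProduct.tmul_mul_tmul, one_mul,
      mul_one, h.K_F, hEKi, TensorProduct.smul_tmul', TensorProduct.tmul_smul, smul_smul,
      inv_mul_cancel₀ hq2, one_smul]
    have e1 : Us.gen q .E * Us.gen q .F
        = Us.gen q .F * Us.gen q .E + (q - q⁻¹)⁻¹ • (Us.gen q .K - Us.gen q .Ki) := by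
      rw [← h.E_F]; abel
    rw [e1]
    simp only [TensorProduct.tmul_add, TensorProduct.add_tmul, TensorProduct.tmul_smul,
      TensorProduct.smul_tmul', TensorProduct.tmul_sub, TensorProduct.sub_tmul, smul_sub]
    abel
  · simp [comulFun, h.K_X]
  · simp only [comulFun, add_mul, mul_add, Algebra.TensorProduct.tmul_mul_tmul, one_mul,
      mul_one, h.K_E, TensorProduct.smul_tmul', TensorProduct.tmul_smul, smul_add]
  · simp only [comulFun, add_mul, mul_add, Algebra.TensorProduct.tmul_mul_tmul, one_mul,
      mul_one, h.K_F, h.K_Ki, h.Ki_K, TensorProduct.smul_tmul', TensorProduct.tmul_smul,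
      smul_add]
  · simp [comulFun, h.K_Y]
  · have e1 : q • (Us.gen q .Y * Us.gen q .X) - Us.gen q .X * Us.gen q .Y = Us.gen q .Z := h.Y_X
    simp only [comulFun, Algebra.TensorProduct.tmul_mul_tmul, one_mul]
    rw [← e1, TensorProduct.tmul_sub, TensorProduct.tmul_smul]
  · simp only [comulFun, add_mul, mul_add, Algebra.TensorProduct.tmul_mul_tmul, one_mul,
      mul_one, h.E_X, h.K_X, TensorProduct.tmul_smul, smul_add]
  · simp only [comulFun, add_mul, mul_add, Algebra.TensorProduct.tmul_mul_tmul, one_mul,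
      mul_one, h.E_Y, h.K_Y, TensorProduct.tmul_smul, smul_add, TensorProduct.tmul_add]
    abel
  · simp only [comulFun, add_mul, mul_add, Algebra.TensorProduct.tmul_mul_tmul, one_mul,
      mul_one, h.F_X, TensorProduct.tmul_add]
    abel
  · simp only [comulFun, add_mul, mul_add, Algebra.TensorProduct.tmul_mul_tmul, one_mul,
      mul_one, h.F_Y]
  · intro g
    have hc := h.Z_central
    cases g <;> simp only [comulFun, add_mul, mul_add, Algebra.TensorProduct.tmul_mul_tmul,
      one_mul, mul_one, hc]

/-- The algebra homomorphism `Δ : U_q(s) → U_q(s) ⊗ U_q(s)`. -/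
def comul {q : ℂ} (hq : q ≠ 0) : Us q →ₐ[ℂ] Us q ⊗[ℂ] Us q :=
  Us.lift (comulFun q) (comulFun_data hq)

/-- The tensor product over `ℂ` of two `U_q(s)`-modules, with `U_q(s)` acting through `Δ`. -/
def Tens {q : ℂ} (_ : q ≠ 0) (M B : Type*) [AddCommGroup M] [Module ℂ M] [AddCommGroup B]
    [Module ℂ B] : Type _ := M ⊗[ℂ] B

section Tens

variable {q : ℂ} (hq : q ≠ 0) (M B : Type*) [AddCommGroup M] [Module ℂ M] [AddCommGroup B]
  [Module ℂ B]

instance : AddCommGroup (Tens hq M B) := inferInstanceAs (AddCommGroup (M ⊗[ℂ] B))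
instance : Module ℂ (Tens hq M B) := inferInstanceAs (Module ℂ (M ⊗[ℂ] B))

variable [Module (Us q) M] [IsScalarTower ℂ (Us q) M] [Module (Us q) B]
  [IsScalarTower ℂ (Us q) B]

/-- The action of `U_q(s)` on the tensor product: if `Δ u = ∑ u_i ⊗ w_i`, then
`u (m ⊗ b) = ∑ u_i m ⊗ w_i b`. -/
def Tens.act : Us q →ₐ[ℂ] Module.End ℂ (M ⊗[ℂ] B) :=
  ((Module.endTensorEndAlgHom (R := ℂ) (S := ℂ) (A := ℂ) (M := M) (N := B)).comp
    (Algebra.TensorProduct.map (Algebra.lsmul ℂ ℂ M : Us q →ₐ[ℂ] Module.End ℂ M)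
      (Algebra.lsmul ℂ ℂ B : Us q →ₐ[ℂ] Module.End ℂ B))).comp (comul hq)

instance : Module (Us q) (Tens hq M B) :=
  Module.compHom (M ⊗[ℂ] B) (Tens.act hq M B).toRingHom

instance : IsScalarTower ℂ (Us q) (Tens hq M B) where
  smul_assoc c u x := by
    change Tens.act hq M B (c • u) x = c • Tens.act hq M B u x
    rw [map_smul]; rfl

end Tens

/-! ### Inflation of `U_q(sl_2)`-modules -/

/-- Images of the generators of `U_q(s)` under the projection onto `U_q(sl_2)`. -/
def projFun (q : ℂ) : SGen → Ul q
  | .E => Ul.gen q .E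
  | .F => Ul.gen q .F
  | .K => Ul.gen q .K
  | .Ki => Ul.gen q .Ki
  | .X => 0
  | .Y => 0
  | .Z => 0

theorem projFun_data (q : ℂ) : SData q (projFun q) := by
  have hk : Ul.gen q .Ki * Ul.gen q .K = 1 := by
    have := Ul.mk_eq (LRel.Ki_K (q := q)); rw [map_mul, map_one] at this; exact this
  constructor
  · have := Ul.mk_eq (LRel.K_Ki (q := q)); rw [map_mul, map_one] at this; exact this
  · exact hk
  · have := Ul.mk_eq (LRel.E_F (q := q))
    rw [map_sub, map_mul, map_mul, map_smul, map_sub] at this; exact this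
  · simp [projFun]
  · have := Ul.mk_eq (LRel.K_E (q := q))
    rw [map_mul, map_mul, map_smul] at this; exact conj_rel hk this
  · have := Ul.mk_eq (LRel.K_F (q := q))
    rw [map_mul, map_mul, map_smul] at this; exact conj_rel hk this
  all_goals simp [projFun]

/-- The projection `U_q(s) → U_q(sl_2)` which kills `X`, `Y`, `Z` and fixes `E`, `F`, `K`. -/
def proj (q : ℂ) : Us q →ₐ[ℂ] Ul q := Us.lift (projFun q) (projFun_data q)

/-- The `U_q(s)`-module `Ñ`: the `U_q(sl_2)`-module `N` on which `X`, `Y`, `Z` act by zero. -/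
def Infl (_ : ℂ) (N : Type*) : Type _ := N

section Infl

variable (q : ℂ) (N : Type*) [AddCommGroup N] [Module ℂ N]

instance : AddCommGroup (Infl q N) := inferInstanceAs (AddCommGroup N)
instance : Module ℂ (Infl q N) := inferInstanceAs (Module ℂ N)

variable [Module (Ul q) N] [IsScalarTower ℂ (Ul q) N]

instance : Module (Us q) (Infl q N) := Module.compHom N (proj q).toRingHom

instance : IsScalarTower ℂ (Us q) (Infl q N) where
  smul_assoc c u x := by
    exact (congrArg (fun a : Ul q => a • (show N from x)) (map_smul (proj q) c u)).trans
      (smul_assoc c (proj q u) (show N from x))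

end Infl

/-! ### The module `B̃_z` -/

/-- The basis vector `v_i` of the complex vector space with basis `v_0, v_1, v_2, …`. -/
def bvec (i : ℕ) : ℕ →₀ ℂ := Finsupp.single i 1

/-- The linear operator which maps `v_i` to `f i`. -/
def opOf (f : ℕ → (ℕ →₀ ℂ)) : Module.End ℂ (ℕ →₀ ℂ) := Finsupp.linearCombination ℂ f

@[simp] theorem opOf_bvec (f : ℕ → (ℕ →₀ ℂ)) (i : ℕ) : opOf f (bvec i) = f i := by
  simp [opOf, bvec]

theorem end_ext {f g : Module.End ℂ (ℕ →₀ ℂ)} (h : ∀ i, f (bvec i) = g (bvec i)) : f = g := by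
  apply Finsupp.lhom_ext'; intro i; apply LinearMap.ext_ring; exact h i

/-- The operators of the generators of `U_q(s)` on `B̃_z`; `p` is the chosen square root of `q`.
In the formulas for `X` and `E` the coefficient vanishes whenever the truncated index differs
from the true one. -/
def BFun (q p z : ℂ) : SGen → Module.End ℂ (ℕ →₀ ℂ)
  | .X => opOf fun i => (-(z * (q ^ i - 1) / (q - 1))) • bvec (i - 1)
  | .Y => opOf fun i => bvec (i + 1)
  | .Z => opOf fun i => z • bvec i
  | .K => opOf fun i => (p⁻¹ * (q ^ i)⁻¹) • bvec i
  | .Ki => opOf fun i => (p * q ^ i) • bvec i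
  | .F => opOf fun i => (p / (z * (q + 1))) • bvec (i + 2)
  | .E => opOf fun i => (-z * (q ^ i - 1) * (q ^ ((i : ℤ) - 1) - 1) /
      (q ^ ((i : ℤ) - 2) * (q ^ 2 - 1) * (q - 1))) • bvec (i - 2)

/-- The coefficient of `E v_i`, with the exponents rewritten in `i - 2`. -/
theorem BFun_E_add_two (q p z : ℂ) (n : ℕ) : BFun q p z .E (bvec (n + 2)) =
    (-z * (q ^ (n + 2) - 1) * (q ^ (n + 1) - 1) / (q ^ n * (q ^ 2 - 1) * (q - 1))) • bvec n := by
  have e1 : (((n + 2 : ℕ) : ℤ) - 1) = ((n + 1 : ℕ) : ℤ) := by push_cast; ring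
  have e2 : (((n + 2 : ℕ) : ℤ) - 2) = (n : ℤ) := by push_cast; ring
  simp only [BFun, opOf_bvec, e1, e2, zpow_natCast, Nat.add_sub_cancel]

theorem BFun_data {q p z : ℂ} (hq0 : q ≠ 0) (hq : ∀ n : ℕ, 0 < n → q ^ n ≠ 1)
    (hp : p ^ 2 = q) (hz : z ≠ 0) : SData q (BFun q p z) := by
  have hp0 : p ≠ 0 := by rintro rfl; simp at hp; exact hq0 hp.symm
  have h1 : q - 1 ≠ 0 := sub_ne_zero.2 (by simpa using hq 1 one_pos)
  have h2 : q ^ 2 - 1 ≠ 0 := sub_ne_zero.2 (hq 2 two_pos)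
  have h3 : q + 1 ≠ 0 := by
    intro h; apply h2; linear_combination (q - 1) * h
  have hKi : ∀ i, BFun q p z .Ki (bvec i) = (p * q ^ i) • bvec i := fun i => opOf_bvec _ i
  have hK : ∀ i, BFun q p z .K (bvec i) = (p⁻¹ * (q ^ i)⁻¹) • bvec i := fun i => opOf_bvec _ i
  have hY : ∀ i, BFun q p z .Y (bvec i) = bvec (i + 1) := fun i => opOf_bvec _ i
  have hZ : ∀ i, BFun q p z .Z (bvec i) = z • bvec i := fun i => opOf_bvec _ i
  have hF : ∀ i, BFun q p z .F (bvec i) = (p / (z * (q + 1))) • bvec (i + 2) :=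
    fun i => opOf_bvec _ i
  have hX0 : BFun q p z .X (bvec 0) = 0 := by simp [BFun]
  have hX : ∀ i, BFun q p z .X (bvec (i + 1)) = (-(z * (q ^ (i + 1) - 1) / (q - 1))) • bvec i :=
    fun i => opOf_bvec _ (i + 1)
  have hE0 : BFun q p z .E (bvec 0) = 0 := by simp [BFun]
  have hE1 : BFun q p z .E (bvec 1) = 0 := by simp [BFun]
  have hE := BFun_E_add_two q p z
  have hZc : BFun q p z .Z = algebraMap ℂ _ z := end_ext fun i => by
    rw [hZ, Module.algebraMap_end_apply]
  generalize BFun q p z = B at *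
  have h4 : (q - q⁻¹)⁻¹ = q / (q ^ 2 - 1) := by field_simp
  constructor
  case Z_central => intro g; rw [hZc]; exact Algebra.commutes z (B g)
  all_goals apply end_ext
  case K_Ki =>
    intro i
    simp only [Module.End.mul_apply, hK, hKi, map_smul, smul_smul, Module.End.one_apply]
    convert one_smul ℂ (bvec i) using 2
    field_simp
  case Ki_K =>
    intro i
    simp only [Module.End.mul_apply, hK, hKi, map_smul, smul_smul, Module.End.one_apply]
    convert one_smul ℂ (bvec i) using 2
    field_simp
  case E_F =>
    rintro (_ | _ | i) <;>
    simp only [Module.End.mul_apply, LinearMap.sub_apply, LinearMap.smul_apply, hF, hE, hE0, hE1,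
      hK, hKi, map_smul, smul_smul, ← sub_smul, zero_add, map_zero, sub_zero] <;>
    congr 1 <;> rw [h4] <;> field_simp <;> rw [hp] <;> ring
  case Y_X =>
    rintro (_ | i) <;>
    simp only [Module.End.mul_apply, LinearMap.sub_apply, LinearMap.smul_apply, hX, hX0, hY, hZ,
      map_smul, smul_smul, ← sub_smul, zero_add, map_zero, smul_zero, zero_sub, ← neg_smul] <;>
    congr 1 <;> field_simp <;> ring
  case F_X =>
    rintro (_ | i) <;>
    simp only [Module.End.mul_apply, LinearMap.add_apply, hX, hX0, hY, hF, hKi,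
      map_smul, smul_smul, ← add_smul, zero_add, map_zero]
    · rw [← zero_smul ℂ (bvec 1)]
      congr 1; field_simp; ring
    · congr 1
      field_simp
      ring
  all_goals rintro (_ | _ | _ | i) <;>
    simp only [Module.End.mul_apply, LinearMap.smul_apply,
      LinearMap.add_apply, hF, hE, hE0, hE1, hX, hX0, hY,
      hK, map_smul, smul_smul, ← add_smul, zero_add, map_zero,
      smul_zero, add_zero]
  all_goals congr 1
  all_goals field_simp
  all_goals ring

/-- The module `B̃_z`, `z ≠ 0`, over `U_q(s)`, for the square root `p` of `q`: the complex vector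
space with basis `v_0, v_1, …`, on which the generators act by the operators `BFun`. -/
def Btilde {q p z : ℂ} (_ : q ≠ 0) (_ : ∀ n : ℕ, 0 < n → q ^ n ≠ 1) (_ : p ^ 2 = q)
    (_ : z ≠ 0) : Type := ℕ →₀ ℂ

section Btilde

variable {q p z : ℂ} (hq0 : q ≠ 0) (hq : ∀ n : ℕ, 0 < n → q ^ n ≠ 1) (hp : p ^ 2 = q)
  (hz : z ≠ 0)

instance : AddCommGroup (Btilde hq0 hq hp hz) := inferInstanceAs (AddCommGroup (ℕ →₀ ℂ))
instance : Module ℂ (Btilde hq0 hq hp hz) := inferInstanceAs (Module ℂ (ℕ →₀ ℂ))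

/-- The action of `U_q(s)` on `B̃_z`. -/
def Btilde.act : Us q →ₐ[ℂ] Module.End ℂ (ℕ →₀ ℂ) :=
  Us.lift (BFun q p z) (BFun_data hq0 hq hp hz)

instance : Module (Us q) (Btilde hq0 hq hp hz) :=
  Module.compHom (ℕ →₀ ℂ) (Btilde.act hq0 hq hp hz).toRingHom

instance : IsScalarTower ℂ (Us q) (Btilde hq0 hq hp hz) where
  smul_assoc c u x := by
    change Btilde.act hq0 hq hp hz (c • u) x = c • Btilde.act hq0 hq hp hz u x
    rw [map_smul]; rfl

/-- The basis vector `v_i` of `B̃_z`. -/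
def Btilde.v (i : ℕ) : Btilde hq0 hq hp hz := bvec i

theorem Btilde.gen_smul (g : SGen) (x : Btilde hq0 hq hp hz) :
    Us.gen q g • x = BFun q p z g x := by
  change Btilde.act hq0 hq hp hz (Us.gen q g) x = _
  rw [Btilde.act, Us.lift_gen]

/-! The restriction of `B̃_z` to the quantum Weyl algebra `H_q` is `H_q / (H_q (Z - z) + H_q X)`. -/

/-- The quantum Weyl algebra `H_q`, the subalgebra of `U_q(s)` generated by `X`, `Y`, `Z`. -/
def Hq (q : ℂ) : Subalgebra ℂ (Us q) :=
  Algebra.adjoin ℂ {Us.gen q .X, Us.gen q .Y, Us.gen q .Z}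

/-- The generator `X` of `H_q`. -/
def Hq.X (q : ℂ) : Hq q := ⟨Us.gen q .X, Algebra.subset_adjoin (by simp)⟩
/-- The generator `Y` of `H_q`. -/
def Hq.Y (q : ℂ) : Hq q := ⟨Us.gen q .Y, Algebra.subset_adjoin (by simp)⟩
/-- The generator `Z` of `H_q`. -/
def Hq.Z (q : ℂ) : Hq q := ⟨Us.gen q .Z, Algebra.subset_adjoin (by simp)⟩

/-- The left ideal `H_q (Z - z) + H_q X` of `H_q`. -/
def Hq.leftIdeal (q z : ℂ) : Submodule (Hq q) (Hq q) :=
  Submodule.span (Hq q) {Hq.Z q - algebraMap ℂ (Hq q) z, Hq.X q}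

/-- The `H_q`-linear map `H_q → B̃_z`, `h ↦ h v_0`. -/
def Btilde.orbit : Hq q →ₗ[Hq q] Btilde hq0 hq hp hz :=
  LinearMap.toSpanSingleton (Hq q) (Btilde hq0 hq hp hz) (Btilde.v hq0 hq hp hz 0)

theorem Btilde.Y_pow (i : ℕ) :
    (Hq.Y q ^ i) • Btilde.v hq0 hq hp hz 0 = Btilde.v hq0 hq hp hz i := by
  induction i with
  | zero => simp
  | succ n ih =>
    rw [pow_succ', mul_smul, ih]
    change Us.gen q .Y • Btilde.v hq0 hq hp hz n = _
    rw [Btilde.gen_smul]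
    exact opOf_bvec _ n

theorem Hq.span_sup_leftIdeal (q z : ℂ) (h : Hq q) :
    h ∈ Submodule.span ℂ (Set.range fun i : ℕ => Hq.Y q ^ i) ⊔
      (Hq.leftIdeal q z).restrictScalars ℂ := by
  set S := Submodule.span ℂ (Set.range fun i : ℕ => Hq.Y q ^ i) ⊔
      (Hq.leftIdeal q z).restrictScalars ℂ with hS
  have hI : ∀ a ∈ Hq.leftIdeal q z, a ∈ S := fun a ha => Submodule.mem_sup_right ha
  have hpow : ∀ i, Hq.Y q ^ i ∈ S := fun i =>
    Submodule.mem_sup_left (Submodule.subset_span ⟨i, rfl⟩)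
  have key : ∀ a : Hq q, (∀ i, a * Hq.Y q ^ i ∈ S) → ∀ s ∈ S, a * s ∈ S := by
    intro a ha s hs
    obtain ⟨b, hb, j, hj, rfl⟩ := Submodule.mem_sup.1 hs
    rw [mul_add]
    refine S.add_mem ?_ (hI _ ((Hq.leftIdeal q z).smul_mem a hj))
    have : Submodule.span ℂ (Set.range fun i : ℕ => Hq.Y q ^ i) ≤
        S.comap (LinearMap.mulLeft ℂ a) := by
      rw [Submodule.span_le]
      rintro _ ⟨i, rfl⟩
      exact ha i
    exact this hb
  have hY : ∀ s ∈ S, Hq.Y q * s ∈ S := key _ fun i => by rw [← pow_succ']; exact hpow _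
  have hcomm : ∀ a : Hq q, Hq.Z q * a = a * Hq.Z q := by
    have : ∀ u ∈ Hq q, Us.gen q .Z * u = u * Us.gen q .Z := by
      intro u hu
      induction hu using Algebra.adjoin_induction with
      | mem x hx =>
        rcases hx with rfl | rfl | rfl <;> exact (Us.data q).Z_central _
      | algebraMap r => exact (Algebra.commutes r _).symm
      | add x y _ _ hx hy => rw [mul_add, add_mul, hx, hy]
      | mul x y _ _ hx hy => rw [← mul_assoc, hx, mul_assoc, hy, mul_assoc]
    exact fun a => Subtype.ext (this a a.2)
  have hZ : ∀ s ∈ S, Hq.Z q * s ∈ S := key _ fun i => by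
    rw [hcomm]
    have e : Hq.Y q ^ i * Hq.Z q =
        Hq.Y q ^ i * (Hq.Z q - algebraMap ℂ (Hq q) z) + z • Hq.Y q ^ i := by
      rw [mul_sub, ← Algebra.commutes, ← Algebra.smul_def]; abel
    rw [e]
    exact S.add_mem (hI _ ((Hq.leftIdeal q z).smul_mem _ (Submodule.subset_span (by simp))))
      (S.smul_mem _ (hpow i))
  have hYX : Hq.X q * Hq.Y q = q • (Hq.Y q * Hq.X q) - Hq.Z q := by
    apply Subtype.ext
    change Us.gen q .X * Us.gen q .Y = q • (Us.gen q .Y * Us.gen q .X) - Us.gen q .Z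
    rw [← (Us.data q).Y_X]; abel
  have hX : ∀ s ∈ S, Hq.X q * s ∈ S := key _ fun i => by
    induction i with
    | zero => rw [pow_zero, mul_one]; exact hI _ (Submodule.subset_span (by simp))
    | succ n ih =>
      rw [pow_succ', ← mul_assoc, hYX, sub_mul, smul_mul_assoc, mul_assoc]
      exact S.sub_mem (S.smul_mem _ (hY _ ih)) (hZ _ (hpow n))
  have hall : ∀ u (hu : u ∈ Hq q), ∀ s ∈ S, (⟨u, hu⟩ : Hq q) * s ∈ S := by
    intro u hu
    induction hu using Algebra.adjoin_induction with
    | mem x hx =>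
      rcases hx with rfl | rfl | rfl
      · exact hX
      · exact hY
      · exact hZ
    | algebraMap r =>
      intro s hs
      have : algebraMap ℂ (Hq q) r * s ∈ S := by
        rw [← Algebra.smul_def]; exact S.smul_mem r hs
      exact this
    | add x y hx hy ihx ihy =>
      intro s hs
      have := S.add_mem (ihx s hs) (ihy s hs)
      rwa [← add_mul] at this
    | mul x y hx hy ihx ihy =>
      intro s hs
      have := ihx _ (ihy s hs)
      rwa [← mul_assoc] at this
  have := hall h.1 h.2 (Hq.Y q ^ 0) (hpow 0)
  rwa [pow_zero, mul_one] at this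

theorem Btilde.orbit_sum (c : ℕ →₀ ℂ) :
    Btilde.orbit hq0 hq hp hz (c.sum fun i a => a • Hq.Y q ^ i) =
      (show Btilde hq0 hq hp hz from c) := by
  have hv : ∀ i, Btilde.orbit hq0 hq hp hz (Hq.Y q ^ i) = Btilde.v hq0 hq hp hz i :=
    Btilde.Y_pow hq0 hq hp hz
  have hs : ∀ (a : ℂ) (h : Hq q), Btilde.orbit hq0 hq hp hz (a • h) =
      a • Btilde.orbit hq0 hq hp hz h := by
    intro a h
    exact smul_assoc a (h : Us q) (Btilde.v hq0 hq hp hz 0)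
  rw [Finsupp.sum, map_sum]
  simp only [hs, hv]
  change (∑ i ∈ c.support, c i • Finsupp.single i (1 : ℂ) : ℕ →₀ ℂ) = c
  conv_rhs => rw [← Finsupp.sum_single c]
  simp [Finsupp.sum]

theorem Btilde.orbit_surjective : Function.Surjective (Btilde.orbit hq0 hq hp hz) :=
  fun c => ⟨_, Btilde.orbit_sum hq0 hq hp hz c⟩

theorem Btilde.ker_orbit :
    LinearMap.ker (Btilde.orbit hq0 hq hp hz) = Hq.leftIdeal q z := by
  have hle : Hq.leftIdeal q z ≤ LinearMap.ker (Btilde.orbit hq0 hq hp hz) := by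
    refine Submodule.span_le.2 ?_
    rintro _ (rfl | rfl)
    · change (Us.gen q .Z - algebraMap ℂ (Us q) z) • Btilde.v hq0 hq hp hz 0 = 0
      rw [sub_smul, algebraMap_smul, Btilde.gen_smul]
      exact sub_eq_zero.2 (opOf_bvec _ 0)
    · change Us.gen q .X • Btilde.v hq0 hq hp hz 0 = 0
      rw [Btilde.gen_smul]
      refine (opOf_bvec _ 0).trans ?_
      simp only [pow_zero, sub_self, mul_zero, zero_div, neg_zero, zero_smul]
      rfl
  refine le_antisymm (fun h hh => ?_) hle
  obtain ⟨b, hb, j, hj, rfl⟩ := Submodule.mem_sup.1 (Hq.span_sup_leftIdeal q z h)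
  obtain ⟨c, rfl⟩ := Finsupp.mem_span_range_iff_exists_finsupp.1 hb
  rw [LinearMap.mem_ker, map_add, LinearMap.mem_ker.1 (hle hj), add_zero,
    Btilde.orbit_sum] at hh
  have hc : c = 0 := hh
  subst hc
  simpa using hj

/-- The isomorphism of `H_q`-modules `H_q / (H_q (Z - z) + H_q X) ≃ B̃_z`. -/
def Btilde.quotEquiv : (Hq q ⧸ Hq.leftIdeal q z) ≃ₗ[Hq q] Btilde hq0 hq hp hz :=
  (Submodule.quotEquivOfEq _ _ (Btilde.ker_orbit hq0 hq hp hz).symm).trans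
    ((Btilde.orbit hq0 hq hp hz).quotKerEquivOfSurjective
      (Btilde.orbit_surjective hq0 hq hp hz))

/-- Under this isomorphism the image of `Y ^ i` corresponds to `v_i`. -/
theorem Btilde.quotEquiv_Y_pow (i : ℕ) :
    Btilde.quotEquiv hq0 hq hp hz (Submodule.Quotient.mk (Hq.Y q ^ i)) =
      Btilde.v hq0 hq hp hz i :=
  Btilde.Y_pow hq0 hq hp hz i

end Btilde

end QSchr

end

noncomputable section

namespace QSchr

/-! ### Generation and the universal property -/

/-! The module N is the kernel of X in V, and the isomorphism sends n ⊗ v_i to Y^i n. It rests on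
two facts.

The first fact is that V is freely built from ker X by powers of Y. For n in ker X, the relation XY
= qYX - z gives X Y^(i+1) n = -z(1 + q + ... + q^i) Y^i n (`X_Y_pow`). The coefficient is nonzero
because z ≠ 0 and q is not a root of unity. So X acts as an invertible lowering operator on the
tower Y^i n, which makes the sum of the Y^i (ker X) direct (`eq_zero_of_sum_Y_pow`). In category O
the operator X is moreover locally nilpotent (`InO.exists_X_pow_eq_zero`), and descending along
powers of X shows that this sum is all of V (`Tens.phi_surjective`).

The second fact is that ker X carries an action of U_q(sl_2), which is generally not the restriction
of the given one. Evaluating the coproduct on n ⊗ v_0 forces it: K v_0 = p⁻¹ v_0 and E v_0 = 0 make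
K and E on N equal to pK and pE on V, while F v_0 ∈ ℂ v_2 makes F on N equal to F - (z(q+1))⁻¹ Y²
K⁻¹ on V. These operators preserve ker X (`vacOp_mem_kerX`) and satisfy the relations of U_q(sl_2)
there (`vacFun_data`). The map is then equivariant on N ⊗ v_0 by construction, and the relations
between Y and the other generators carry this to every N ⊗ v_i (`Tens.phi_gen_smul`).

Finally N lies in category O. Weights and local finiteness pass to the kernel of X, and finite
generation is pulled back from N ⊗ B to N (`finite_of_finite_tens`). -/

theorem Us.adjoin_range_gen (q : ℂ) : Algebra.adjoin ℂ (Set.range (Us.gen q)) = ⊤ := by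
  let f : FreeAlgebra ℂ SGen →ₐ[ℂ] Us q := RingQuot.mkAlgHom ℂ (SRel q)
  have hf : Function.Surjective f := RingQuot.mkAlgHom_surjective ℂ (SRel q)
  have h : Set.range (Us.gen q) = f '' Set.range (FreeAlgebra.ι ℂ) := by
    rw [← Set.range_comp]; rfl
  rw [h, ← AlgHom.map_adjoin, FreeAlgebra.adjoin_range_ι, Algebra.map_top,
    AlgHom.range_eq_top]
  exact hf

/-- A complex subspace of a `U_q(s)`-module which is stable under the generators is stable
under `U_q(s)`. -/
theorem Us.smul_mem_of_gen {q : ℂ} {M : Type*} [AddCommGroup M] [Module ℂ M] [Module (Us q) M]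
    [IsScalarTower ℂ (Us q) M] (S : Submodule ℂ M)
    (h : ∀ g, ∀ m ∈ S, Us.gen q g • m ∈ S) (u : Us q) : ∀ m ∈ S, u • m ∈ S := by
  have hu : u ∈ Algebra.adjoin ℂ (Set.range (Us.gen q)) := by
    rw [Us.adjoin_range_gen]; trivial
  induction hu using Algebra.adjoin_induction with
  | mem x hx => obtain ⟨g, rfl⟩ := hx; exact h g
  | algebraMap r => intro m hm; rw [algebraMap_smul]; exact S.smul_mem r hm
  | add x y _ _ hx hy => intro m hm; rw [add_smul]; exact S.add_mem (hx m hm) (hy m hm)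
  | mul x y _ _ hx hy => intro m hm; rw [mul_smul]; exact hx _ (hy m hm)

/-- A `ℂ`-linear map between `U_q(s)`-modules which commutes with the generators commutes
with `U_q(s)`. -/
theorem Us.map_smul_of_gen {q : ℂ} {M M' : Type*} [AddCommGroup M] [Module ℂ M]
    [Module (Us q) M] [IsScalarTower ℂ (Us q) M] [AddCommGroup M'] [Module ℂ M']
    [Module (Us q) M'] [IsScalarTower ℂ (Us q) M'] (f : M →ₗ[ℂ] M')
    (h : ∀ g m, f (Us.gen q g • m) = Us.gen q g • f m) (u : Us q) (m : M) :
    f (u • m) = u • f m := by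
  have hu : u ∈ Algebra.adjoin ℂ (Set.range (Us.gen q)) := by
    rw [Us.adjoin_range_gen]; trivial
  induction hu using Algebra.adjoin_induction generalizing m with
  | mem x hx => obtain ⟨g, rfl⟩ := hx; exact h g m
  | algebraMap r => rw [algebraMap_smul, algebraMap_smul, map_smul]
  | add x y _ _ hx hy => rw [add_smul, add_smul, map_add, hx, hy]
  | mul x y _ _ hx hy => rw [mul_smul, mul_smul, hx, hy]

/-- Data for an algebra homomorphism out of `U_q(sl_2)`. -/
structure LData (q : ℂ) {A : Type*} [Ring A] [Algebra ℂ A] (f : LGen → A) : Prop where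
  K_Ki : f .K * f .Ki = 1
  Ki_K : f .Ki * f .K = 1
  E_F : f .E * f .F - f .F * f .E = (q - q⁻¹)⁻¹ • (f .K - f .Ki)
  K_E : f .K * f .E = q ^ 2 • (f .E * f .K)
  K_F : f .K * f .F = (q ^ 2)⁻¹ • (f .F * f .K)

/-- The universal property of `U_q(sl_2)`. -/
def Ul.lift {q : ℂ} {A : Type*} [Ring A] [Algebra ℂ A] (f : LGen → A) (h : LData q f) :
    Ul q →ₐ[ℂ] A :=
  RingQuot.liftAlgHom ℂ ⟨FreeAlgebra.lift ℂ f, by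
    intro x y hxy
    cases hxy with
    | K_Ki => simpa using h.K_Ki
    | Ki_K => simpa using h.Ki_K
    | E_F => simpa using h.E_F
    | K_E =>
      simp only [map_mul, map_smul, FreeAlgebra.lift_ι_apply, h.K_E, smul_mul_assoc]
      rw [mul_assoc, h.K_Ki, mul_one]
    | K_F =>
      simp only [map_mul, map_smul, FreeAlgebra.lift_ι_apply, h.K_F, smul_mul_assoc]
      rw [mul_assoc, h.K_Ki, mul_one]⟩

@[simp] theorem Ul.lift_gen {q : ℂ} {A : Type*} [Ring A] [Algebra ℂ A] (f : LGen → A)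
    (h : LData q f) (g : LGen) : Ul.lift f h (Ul.gen q g) = f g := by
  unfold Ul.lift Ul.gen
  erw [RingQuot.liftAlgHom_mkAlgHom_apply]
  simp

/-! ### Operators of the generators -/

/-- The relations of `U_q(s)` evaluated on a vector of a module. -/
structure SAct (q : ℂ) {M : Type*} [AddCommGroup M] [Module ℂ M] (T : SGen → M →ₗ[ℂ] M) :
    Prop where
  K_Ki : ∀ m, T .K (T .Ki m) = m
  Ki_K : ∀ m, T .Ki (T .K m) = m
  E_F : ∀ m, T .E (T .F m) = T .F (T .E m) + (q - q⁻¹)⁻¹ • (T .K m - T .Ki m)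
  K_X : ∀ m, T .K (T .X m) = q • T .X (T .K m)
  K_E : ∀ m, T .K (T .E m) = q ^ 2 • T .E (T .K m)
  K_F : ∀ m, T .K (T .F m) = (q ^ 2)⁻¹ • T .F (T .K m)
  K_Y : ∀ m, T .K (T .Y m) = q⁻¹ • T .Y (T .K m)
  X_Y : ∀ m, T .X (T .Y m) = q • T .Y (T .X m) - T .Z m
  E_X : ∀ m, T .E (T .X m) = q • T .X (T .E m)
  E_Y : ∀ m, T .E (T .Y m) = T .X m + q⁻¹ • T .Y (T .E m)
  X_F : ∀ m, T .X (T .F m) = T .F (T .X m) - T .Y (T .Ki m)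
  F_Y : ∀ m, T .F (T .Y m) = T .Y (T .F m)
  Z_central : ∀ g m, T .Z (T g m) = T g (T .Z m)

/-- The operator by which a generator of `U_q(s)` acts on a module. -/
def op (q : ℂ) (M : Type*) [AddCommGroup M] [Module ℂ M] [Module (Us q) M]
    [IsScalarTower ℂ (Us q) M] (g : SGen) : M →ₗ[ℂ] M :=
  Algebra.lsmul ℂ ℂ M (Us.gen q g)

theorem op_apply {q : ℂ} {M : Type*} [AddCommGroup M] [Module ℂ M] [Module (Us q) M]
    [IsScalarTower ℂ (Us q) M] (g : SGen) (m : M) : op q M g m = Us.gen q g • m := rfl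

/-- The relations for YX and FX are solved for XY and XF, so that as rewrite rules they move X next
to the vector, where it vanishes on ker X. -/
theorem op_act (q : ℂ) (M : Type*) [AddCommGroup M] [Module ℂ M] [Module (Us q) M]
    [IsScalarTower ℂ (Us q) M] : SAct q (op q M) := by
  have h := Us.data q
  have e : ∀ {a b : Us q}, a = b → ∀ m : M, a • m = b • m := fun h m => by rw [h]
  constructor <;> intro m <;> simp only [op_apply]
  · simpa [mul_smul] using e h.K_Ki m
  · simpa [mul_smul] using e h.Ki_K m
  · have := e h.E_F m
    simp only [sub_smul, smul_assoc, mul_smul] at this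
    rw [← this]; abel
  · simpa [mul_smul] using e h.K_X m
  · simpa [mul_smul] using e h.K_E m
  · simpa only [mul_smul, smul_assoc] using e h.K_F m
  · simpa only [mul_smul, smul_assoc] using e h.K_Y m
  · have := e h.Y_X m
    simp only [sub_smul, smul_assoc, mul_smul] at this
    rw [← this]; abel
  · simpa only [mul_smul, smul_assoc] using e h.E_X m
  · simpa only [mul_smul, smul_assoc, add_smul] using e h.E_Y m
  · have := e h.F_X m
    simp only [add_smul, mul_smul] at this
    rw [this]; abel
  · simpa only [mul_smul] using e h.F_Y m
  · intro n
    simpa only [mul_smul] using e (h.Z_central m) n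

theorem SAct.Ki_of_K {q : ℂ} {M : Type*} [AddCommGroup M] [Module ℂ M]
    {T : SGen → M →ₗ[ℂ] M} (h : SAct q T) {g : SGen} {c : ℂ} (hc : c ≠ 0)
    (hg : ∀ m, T .K (T g m) = c • T g (T .K m)) (m : M) :
    T .Ki (T g m) = c⁻¹ • T g (T .Ki m) := by
  have h1 := congrArg (T .Ki) (hg (T .Ki m))
  rw [h.Ki_K, h.K_Ki, map_smul] at h1
  rw [h1, smul_smul, inv_mul_cancel₀ hc, one_smul]

/-! ### The kernel of `X` -/

/-- The kernel of `X` in a `U_q(s)`-module. -/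
def kerX (q : ℂ) (V : Type*) [AddCommGroup V] [Module ℂ V] [Module (Us q) V]
    [IsScalarTower ℂ (Us q) V] : Submodule ℂ V := LinearMap.ker (op q V .X)

/-- The operators on `V` which restrict to the action of `U_q(sl_2)` on the kernel of `X`. -/
def vacOp (q p z : ℂ) (V : Type*) [AddCommGroup V] [Module ℂ V] [Module (Us q) V]
    [IsScalarTower ℂ (Us q) V] : LGen → V →ₗ[ℂ] V
  | .E => p • op q V .E
  | .F => op q V .F - (z * (q + 1))⁻¹ • (op q V .Y ∘ₗ op q V .Y ∘ₗ op q V .Ki)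
  | .K => p • op q V .K
  | .Ki => p⁻¹ • op q V .Ki

section Vac

variable {q p z : ℂ} {V : Type*} [AddCommGroup V] [Module ℂ V] [Module (Us q) V]
  [IsScalarTower ℂ (Us q) V]

theorem mem_kerX {v : V} : v ∈ kerX q V ↔ op q V .X v = 0 := LinearMap.mem_ker

theorem K_mem_kerX (hq0 : q ≠ 0) {v : V} (hv : v ∈ kerX q V) : op q V .K v ∈ kerX q V := by
  rw [mem_kerX] at *
  have h := (op_act q V).K_X v
  rw [hv, map_zero] at h
  exact ((smul_eq_zero.1 h.symm).resolve_left hq0)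

theorem Ki_mem_kerX (hq0 : q ≠ 0) {v : V} (hv : v ∈ kerX q V) : op q V .Ki v ∈ kerX q V := by
  rw [mem_kerX] at *
  have h := (op_act q V).Ki_of_K hq0 (op_act q V).K_X v
  rw [hv, map_zero] at h
  exact ((smul_eq_zero.1 h.symm).resolve_left (inv_ne_zero hq0))

theorem E_mem_kerX (hq0 : q ≠ 0) {v : V} (hv : v ∈ kerX q V) : op q V .E v ∈ kerX q V := by
  rw [mem_kerX] at *
  have h := (op_act q V).E_X v
  rw [hv, map_zero] at h
  exact ((smul_eq_zero.1 h.symm).resolve_left hq0)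

/-- E, K and K⁻¹ commute with X up to a scalar, so only F matters. For v in ker X, X F v = -Y K⁻¹ v
and X Y² K⁻¹ v = -z(q+1) Y K⁻¹ v, so the correction term in F cancels exactly. -/
theorem vacOp_mem_kerX (hq0 : q ≠ 0) (hq1 : q + 1 ≠ 0) (hz : z ≠ 0)
    (hZ : HasCentralCharge q z V) (g : LGen) {v : V} (hv : v ∈ kerX q V) :
    vacOp q p z V g v ∈ kerX q V := by
  have h := op_act q V
  cases g with
  | E => exact Submodule.smul_mem _ _ (E_mem_kerX hq0 hv)
  | K => exact Submodule.smul_mem _ _ (K_mem_kerX hq0 hv)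
  | Ki => exact Submodule.smul_mem _ _ (Ki_mem_kerX hq0 hv)
  | F =>
    have hk := Ki_mem_kerX hq0 hv
    have hZ' : ∀ v, op q V .Z v = z • v := hZ
    rw [mem_kerX] at *
    simp only [vacOp, LinearMap.sub_apply, LinearMap.smul_apply, LinearMap.comp_apply, map_sub,
      map_smul, h.X_F, h.X_Y, hv, hk, hZ', map_zero, smul_zero, zero_sub, map_neg, smul_neg,
      smul_sub, smul_smul]
    rw [← neg_smul, ← sub_smul, ← neg_one_smul ℂ (op q V .Y (op q V .Ki v)), ← sub_smul]
    convert zero_smul ℂ _ using 2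
    field_simp
    ring

/-- The kernel of `X` as a space of its own. -/
def Vac (q p z : ℂ) (V : Type*) [AddCommGroup V] [Module ℂ V] [Module (Us q) V]
    [IsScalarTower ℂ (Us q) V] (_ : q ≠ 0) (_ : q + 1 ≠ 0) (_ : p ^ 2 = q) (_ : q ^ 2 - 1 ≠ 0)
    (_ : z ≠ 0)
    (_ : HasCentralCharge q z V) : Type _ := kerX q V

/-- The operators of the generators of `U_q(sl_2)` on the kernel of `X`. -/
def vacFun (hq0 : q ≠ 0) (hq1 : q + 1 ≠ 0) (hz : z ≠ 0)
    (hZ : HasCentralCharge q z V) (p : ℂ) (g : LGen) : Module.End ℂ (kerX q V) :=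
  (vacOp q p z V g).restrict fun _ hv => vacOp_mem_kerX hq0 hq1 hz hZ g hv

/-- The substantial relation is the one for [E, F]. For v in ker X, E Y² K⁻¹ v = Y² K⁻¹ E v - z K⁻¹
v, so the correction of F adds p(q+1)⁻¹ K⁻¹ to p[E, F]. The coefficient of K⁻¹ becomes -p/(q² - 1),
which equals -p⁻¹/(q - q⁻¹) precisely because p² = q. -/
theorem vacFun_data (hq0 : q ≠ 0) (hq1 : q + 1 ≠ 0) (hp : p ^ 2 = q) (hq2 : q ^ 2 - 1 ≠ 0)
    (hz : z ≠ 0) (hZ : HasCentralCharge q z V) :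
    LData q (vacFun hq0 hq1 hz hZ p) := by
  have hp0 : p ≠ 0 := by rintro rfl; simp at hp; exact hq0 hp.symm
  have h := op_act q V
  have hZ' : ∀ v, op q V .Z v = z • v := hZ
  have hKi := @SAct.Ki_of_K q V _ _ _ h
  have hEKi : ∀ m, op q V .E (op q V .Ki m) = q ^ 2 • op q V .Ki (op q V .E m) := fun m => by
    rw [hKi (pow_ne_zero 2 hq0) h.K_E, smul_smul, mul_inv_cancel₀ (pow_ne_zero 2 hq0), one_smul]
  have hKKi : ∀ m, op q V .Ki (op q V .K m) = op q V .K (op q V .Ki m) := fun m => by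
    rw [h.Ki_K, h.K_Ki]
  constructor <;> refine LinearMap.ext fun ⟨v, hv⟩ => Subtype.ext ?_
  · change vacOp q p z V .K (vacOp q p z V .Ki v) = v
    simp [vacOp, h.K_Ki, smul_smul, hp0]
  · change vacOp q p z V .Ki (vacOp q p z V .K v) = v
    simp [vacOp, h.Ki_K, smul_smul, hp0]
  · change vacOp q p z V .E (vacOp q p z V .F v) - vacOp q p z V .F (vacOp q p z V .E v) =
      (q - q⁻¹)⁻¹ • (vacOp q p z V .K v - vacOp q p z V .Ki v)
    have hk := mem_kerX.1 (Ki_mem_kerX hq0 hv)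
    have h4 : (q - q⁻¹)⁻¹ = q / (q ^ 2 - 1) := by field_simp
    simp only [vacOp, LinearMap.sub_apply, LinearMap.smul_apply, LinearMap.comp_apply, map_sub,
      map_add, map_smul, h.E_Y, h.X_Y, h.E_F, hk, hZ', map_zero, hEKi, h4, smul_zero, zero_sub]
    match_scalars <;> field_simp
    all_goals try rw [hp]
    all_goals ring
  · change vacOp q p z V .K (vacOp q p z V .E v) =
      q ^ 2 • vacOp q p z V .E (vacOp q p z V .K v)
    simp only [vacOp, LinearMap.smul_apply, map_smul, h.K_E]
    module
  · change vacOp q p z V .K (vacOp q p z V .F v) =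
      (q ^ 2)⁻¹ • vacOp q p z V .F (vacOp q p z V .K v)
    simp only [vacOp, LinearMap.sub_apply, LinearMap.smul_apply, LinearMap.comp_apply, map_sub,
      map_smul, h.K_Y, h.K_F, hKKi]
    module

variable (hq0 : q ≠ 0) (hq1 : q + 1 ≠ 0) (hp : p ^ 2 = q) (hq2 : q ^ 2 - 1 ≠ 0)
  (hz : z ≠ 0) (hZ : HasCentralCharge q z V)

instance : AddCommGroup (Vac q p z V hq0 hq1 hp hq2 hz hZ) :=
  inferInstanceAs (AddCommGroup (kerX q V))
instance : Module ℂ (Vac q p z V hq0 hq1 hp hq2 hz hZ) := inferInstanceAs (Module ℂ (kerX q V))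

/-- The action of `U_q(sl_2)` on the kernel of `X`. -/
def Vac.act : Ul q →ₐ[ℂ] Module.End ℂ (kerX q V) :=
  Ul.lift (vacFun hq0 hq1 hz hZ p) (vacFun_data hq0 hq1 hp hq2 hz hZ)

instance : Module (Ul q) (Vac q p z V hq0 hq1 hp hq2 hz hZ) :=
  Module.compHom (kerX q V) (Vac.act hq0 hq1 hp hq2 hz hZ).toRingHom

instance : IsScalarTower ℂ (Ul q) (Vac q p z V hq0 hq1 hp hq2 hz hZ) where
  smul_assoc c u x := by
    change Vac.act hq0 hq1 hp hq2 hz hZ (c • u) x = c • Vac.act hq0 hq1 hp hq2 hz hZ u x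
    rw [map_smul]; rfl

/-- The inclusion of the kernel of `X`. -/
def Vac.incl : Vac q p z V hq0 hq1 hp hq2 hz hZ →ₗ[ℂ] V := (kerX q V).subtype

theorem Vac.incl_injective : Function.Injective (Vac.incl hq0 hq1 hp hq2 hz hZ) :=
  Subtype.val_injective

theorem Vac.X_incl (n : Vac q p z V hq0 hq1 hp hq2 hz hZ) :
    op q V .X (Vac.incl hq0 hq1 hp hq2 hz hZ n) = 0 := mem_kerX.1 (Subtype.prop n)

theorem Vac.exists_incl {v : V} (hv : op q V .X v = 0) :
    ∃ n, Vac.incl hq0 hq1 hp hq2 hz hZ n = v := ⟨⟨v, hv⟩, rfl⟩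

theorem Vac.incl_gen_smul (g : LGen) (n : Vac q p z V hq0 hq1 hp hq2 hz hZ) :
    Vac.incl hq0 hq1 hp hq2 hz hZ (Ul.gen q g • n) =
      vacOp q p z V g (Vac.incl hq0 hq1 hp hq2 hz hZ n) := by
  change ((Vac.act hq0 hq1 hp hq2 hz hZ (Ul.gen q g) n : kerX q V) : V) = _
  rw [Vac.act, Ul.lift_gen]
  rfl

end Vac

/-! ### Tensor products with `B̃_z` -/

section TensorMk

variable {q : ℂ} (hq0 : q ≠ 0) (M B : Type*) [AddCommGroup M] [Module ℂ M] [AddCommGroup B]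
  [Module ℂ B]

/-- The bilinear map `(m, b) ↦ m ⊗ b`. -/
def Tens.mk : M →ₗ[ℂ] B →ₗ[ℂ] Tens hq0 M B := TensorProduct.mk ℂ M B

/-- The span of the tensors `m ⊗ b` with `m` in a given subspace. -/
def Tens.spanLeft (S : Submodule ℂ M) : Submodule ℂ (Tens hq0 M B) :=
  Submodule.span ℂ {t | ∃ m ∈ S, ∃ b, t = Tens.mk hq0 M B m b}

variable {M B}

theorem Tens.mk_mem {S : Submodule ℂ (Tens hq0 M B)} (h : ∀ m b, Tens.mk hq0 M B m b ∈ S)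
    (t : Tens hq0 M B) : t ∈ S := by
  induction t using TensorProduct.induction_on with
  | zero => exact zero_mem _
  | tmul m b => exact h m b
  | add x y hx hy => exact S.add_mem hx hy

theorem Tens.mk_mem_spanLeft {S : Submodule ℂ M} {m : M} (hm : m ∈ S) (b : B) :
    Tens.mk hq0 M B m b ∈ Tens.spanLeft hq0 M B S :=
  Submodule.subset_span ⟨m, hm, b, rfl⟩

theorem Tens.spanLeft_le {S : Submodule ℂ M} {W : Submodule ℂ (Tens hq0 M B)}
    (h : ∀ m ∈ S, ∀ b, Tens.mk hq0 M B m b ∈ W) : Tens.spanLeft hq0 M B S ≤ W := by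
  refine Submodule.span_le.2 ?_
  rintro _ ⟨m, hm, b, rfl⟩
  exact h m hm b

/-- Every element of the tensor product lies in `S ⊗ B` for a finitely generated `S`. -/
theorem Tens.exists_finite_mem_spanLeft (t : Tens hq0 M B) :
    ∃ s : Finset M, ∀ S : Submodule ℂ M, (s : Set M) ⊆ S → t ∈ Tens.spanLeft hq0 M B S := by
  classical
  induction t using TensorProduct.induction_on with
  | zero => exact ⟨∅, fun S _ => zero_mem _⟩
  | tmul m b =>
    exact ⟨{m}, fun S hS => Tens.mk_mem_spanLeft hq0 (hS (by simp)) b⟩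
  | add x y hx hy =>
    obtain ⟨s, hs⟩ := hx
    obtain ⟨s', hs'⟩ := hy
    refine ⟨s ∪ s', fun S hS => ?_⟩
    rw [Finset.coe_union, Set.union_subset_iff] at hS
    exact add_mem (hs S hS.1) (hs' S hS.2)

/-- Contracting the right factor with f maps S ⊗ B into S and m ⊗ b to m. -/
theorem Tens.mem_of_mk_mem_spanLeft (S : Submodule ℂ M) (f : B →ₗ[ℂ] ℂ) {b : B} (hb : f b = 1)
    {m : M} (h : Tens.mk hq0 M B m b ∈ Tens.spanLeft hq0 M B S) : m ∈ S := by
  let φ : Tens hq0 M B →ₗ[ℂ] M :=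
    (TensorProduct.rid ℂ M).toLinearMap ∘ₗ LinearMap.lTensor M f
  have hφ : ∀ m b, φ (Tens.mk hq0 M B m b) = f b • m := fun m b =>
    TensorProduct.rid_tmul m (f b)
  have hle : Tens.spanLeft hq0 M B S ≤ S.comap φ := Tens.spanLeft_le hq0 fun m hm b => by
    rw [Submodule.mem_comap, hφ]
    exact S.smul_mem _ hm
  have := hle h
  rwa [Submodule.mem_comap, hφ, hb, one_smul] at this

variable [Module (Us q) M] [IsScalarTower ℂ (Us q) M] [Module (Us q) B]
  [IsScalarTower ℂ (Us q) B]

/-- The action of `U_q(s) ⊗ U_q(s)` on a tensor product of modules. -/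
def Tens.act₂ : Us q ⊗[ℂ] Us q →ₐ[ℂ] Module.End ℂ (Tens hq0 M B) :=
  (Module.endTensorEndAlgHom (R := ℂ) (S := ℂ) (A := ℂ) (M := M) (N := B)).comp
    (Algebra.TensorProduct.map (Algebra.lsmul ℂ ℂ M : Us q →ₐ[ℂ] Module.End ℂ M)
      (Algebra.lsmul ℂ ℂ B : Us q →ₐ[ℂ] Module.End ℂ B))

theorem Tens.act₂_tmul (a c : Us q) (m : M) (b : B) :
    Tens.act₂ hq0 (a ⊗ₜ c) (Tens.mk hq0 M B m b) = Tens.mk hq0 M B (a • m) (c • b) := rfl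

theorem Tens.gen_smul (g : SGen) (x : Tens hq0 M B) :
    Us.gen q g • x = Tens.act₂ hq0 (comulFun q g) x := by
  change Tens.act hq0 M B (Us.gen q g) x = _
  rw [Tens.act, AlgHom.comp_apply, comul, Us.lift_gen]
  rfl

theorem Tens.E_mk (m : M) (b : B) : Us.gen q .E • Tens.mk hq0 M B m b =
    Tens.mk hq0 M B m (Us.gen q .E • b) +
      Tens.mk hq0 M B (Us.gen q .E • m) (Us.gen q .K • b) := by
  simp only [Tens.gen_smul, comulFun, map_add, LinearMap.add_apply, Tens.act₂_tmul, one_smul]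

theorem Tens.F_mk (m : M) (b : B) : Us.gen q .F • Tens.mk hq0 M B m b =
    Tens.mk hq0 M B (Us.gen q .Ki • m) (Us.gen q .F • b) +
      Tens.mk hq0 M B (Us.gen q .F • m) b := by
  simp only [Tens.gen_smul, comulFun, map_add, LinearMap.add_apply, Tens.act₂_tmul, one_smul]

theorem Tens.K_mk (m : M) (b : B) : Us.gen q .K • Tens.mk hq0 M B m b =
    Tens.mk hq0 M B (Us.gen q .K • m) (Us.gen q .K • b) := by
  simp only [Tens.gen_smul, comulFun, Tens.act₂_tmul]

theorem Tens.Ki_mk (m : M) (b : B) : Us.gen q .Ki • Tens.mk hq0 M B m b =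
    Tens.mk hq0 M B (Us.gen q .Ki • m) (Us.gen q .Ki • b) := by
  simp only [Tens.gen_smul, comulFun, Tens.act₂_tmul]

/-- The generators `X`, `Y`, `Z` act on the right factor only. -/
theorem Tens.XYZ_mk {g : SGen} (hg : comulFun q g = 1 ⊗ₜ Us.gen q g) (m : M) (b : B) :
    Us.gen q g • Tens.mk hq0 M B m b = Tens.mk hq0 M B m (Us.gen q g • b) := by
  rw [Tens.gen_smul, hg, Tens.act₂_tmul, one_smul]

/-- Every term of the coproduct of a generator acts on the left factor by 1 or by a generator. -/
theorem Tens.gen_smul_mem_spanLeft (S : Submodule ℂ M)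
    (hS : ∀ g, ∀ m ∈ S, Us.gen q g • m ∈ S) (g : SGen) :
    ∀ t ∈ Tens.spanLeft hq0 M B S, Us.gen q g • t ∈ Tens.spanLeft hq0 M B S := by
  have hm : ∀ m ∈ S, ∀ b, Tens.mk hq0 M B m b ∈ Tens.spanLeft hq0 M B S := fun m hm b =>
    Tens.mk_mem_spanLeft hq0 hm b
  suffices h : Tens.spanLeft hq0 M B S ≤
    (Tens.spanLeft hq0 M B S).comap (op q (Tens hq0 M B) g) by
    intro t ht
    exact h ht
  refine Tens.spanLeft_le hq0 fun m hmS b => ?_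
  change Us.gen q g • Tens.mk hq0 M B m b ∈ Tens.spanLeft hq0 M B S
  cases g with
  | E => rw [Tens.E_mk]; exact add_mem (hm _ hmS _) (hm _ (hS _ _ hmS) _)
  | F => rw [Tens.F_mk]; exact add_mem (hm _ (hS _ _ hmS) _) (hm _ (hS _ _ hmS) _)
  | K => rw [Tens.K_mk]; exact hm _ (hS _ _ hmS) _
  | Ki => rw [Tens.Ki_mk]; exact hm _ (hS _ _ hmS) _
  | X => rw [Tens.XYZ_mk hq0 rfl]; exact hm _ hmS _
  | Y => rw [Tens.XYZ_mk hq0 rfl]; exact hm _ hmS _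
  | Z => rw [Tens.XYZ_mk hq0 rfl]; exact hm _ hmS _

end TensorMk

/-- The identity map `Ñ → N`. -/
def Infl.out (q : ℂ) (N : Type*) [AddCommGroup N] [Module ℂ N] : Infl q N ≃ₗ[ℂ] N :=
  LinearEquiv.refl ℂ N

theorem Infl.out_gen_smul {q : ℂ} {N : Type*} [AddCommGroup N] [Module ℂ N] [Module (Ul q) N]
    [IsScalarTower ℂ (Ul q) N] (g : SGen) (n : Infl q N) :
    Infl.out q N (Us.gen q g • n) = projFun q g • Infl.out q N n := by
  change proj q (Us.gen q g) • Infl.out q N n = _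
  rw [proj, Us.lift_gen]

/-! ### The comparison map m ⊗ v_i ↦ Y^i (f m): bijectivity and equivariance -/

section Phi

variable {q p z : ℂ} (hq0 : q ≠ 0) (hq : ∀ n : ℕ, 0 < n → q ^ n ≠ 1) (hp : p ^ 2 = q)
  (hz : z ≠ 0)

theorem Btilde.Y_v (i : ℕ) :
    Us.gen q .Y • Btilde.v hq0 hq hp hz i = Btilde.v hq0 hq hp hz (i + 1) :=
  (Btilde.gen_smul hq0 hq hp hz .Y _).trans (opOf_bvec _ i)

theorem Btilde.Z_v (i : ℕ) :
    Us.gen q .Z • Btilde.v hq0 hq hp hz i = z • Btilde.v hq0 hq hp hz i :=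
  (Btilde.gen_smul hq0 hq hp hz .Z _).trans (opOf_bvec _ i)

theorem Btilde.K_v (i : ℕ) : Us.gen q .K • Btilde.v hq0 hq hp hz i =
    (p⁻¹ * (q ^ i)⁻¹) • Btilde.v hq0 hq hp hz i :=
  (Btilde.gen_smul hq0 hq hp hz .K _).trans (opOf_bvec _ i)

theorem Btilde.F_v (i : ℕ) : Us.gen q .F • Btilde.v hq0 hq hp hz i =
    (p / (z * (q + 1))) • Btilde.v hq0 hq hp hz (i + 2) :=
  (Btilde.gen_smul hq0 hq hp hz .F _).trans (opOf_bvec _ i)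

theorem Btilde.X_v_zero : Us.gen q .X • Btilde.v hq0 hq hp hz 0 = 0 :=
  (Btilde.gen_smul hq0 hq hp hz .X _).trans (by simp [BFun, Btilde.v]; rfl)

theorem Btilde.E_v_zero : Us.gen q .E • Btilde.v hq0 hq hp hz 0 = 0 :=
  (Btilde.gen_smul hq0 hq hp hz .E _).trans (by simp [BFun, Btilde.v]; rfl)

theorem Btilde.v_mem {S : Submodule ℂ (Btilde hq0 hq hp hz)}
    (h : ∀ i, Btilde.v hq0 hq hp hz i ∈ S) (b : Btilde hq0 hq hp hz) : b ∈ S := by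
  induction b using Finsupp.induction_linear with
  | zero => exact zero_mem _
  | add x y hx hy => exact S.add_mem hx hy
  | single i c =>
    have e : (Finsupp.single i c : ℕ →₀ ℂ) = c • bvec i := by simp [bvec]
    rw [e]
    exact S.smul_mem c (h i)

variable {V : Type*} [AddCommGroup V] [Module ℂ V] [Module (Us q) V]
  [IsScalarTower ℂ (Us q) V] {M : Type*} [AddCommGroup M] [Module ℂ M]

theorem Tens.mk_v_mem {S : Submodule ℂ (Tens hq0 M (Btilde hq0 hq hp hz))}
    (h : ∀ i m, Tens.mk hq0 M _ m (Btilde.v hq0 hq hp hz i) ∈ S)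
    (t : Tens hq0 M (Btilde hq0 hq hp hz)) : t ∈ S := by
  refine Tens.mk_mem hq0 (fun m b => ?_) t
  have : ∀ b, b ∈ S.comap (Tens.mk hq0 M (Btilde hq0 hq hp hz) m) :=
    Btilde.v_mem hq0 hq hp hz fun i => h i m
  exact this b

/-- The linear map `M ⊗ B̃_z → V`, `m ⊗ v_i ↦ Y^i (f m)`. -/
def Tens.phi (f : M →ₗ[ℂ] V) : Tens hq0 M (Btilde hq0 hq hp hz) →ₗ[ℂ] V :=
  TensorProduct.lift (R := ℂ) (M := M) (N := ℕ →₀ ℂ)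
    (Finsupp.linearCombination ℂ fun i : ℕ => (op q V .Y ^ i) ∘ₗ f).flip

theorem Tens.phi_mk (f : M →ₗ[ℂ] V) (m : M) (i : ℕ) :
    Tens.phi hq0 hq hp hz f (Tens.mk hq0 M _ m (Btilde.v hq0 hq hp hz i)) =
      (op q V .Y ^ i) (f m) := by
  change TensorProduct.lift (R := ℂ) (M := M) (N := ℕ →₀ ℂ) _ (m ⊗ₜ[ℂ] bvec i) = _
  simp [bvec]

/-- Each passage of X across Y multiplies the old coefficient by q and subtracts z, which builds up
a geometric sum. -/
theorem X_Y_pow (hZ : HasCentralCharge q z V) {v : V} (hv : op q V .X v = 0) (i : ℕ) :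
    op q V .X ((op q V .Y ^ (i + 1)) v) =
      (-(z * (∑ j ∈ Finset.range (i + 1), q ^ j))) • (op q V .Y ^ i) v := by
  have h := op_act q V
  have hZ' : ∀ v, op q V .Z v = z • v := hZ
  induction i with
  | zero => simp [h.X_Y, hv, hZ']
  | succ i ih =>
    rw [pow_succ', Module.End.mul_apply, h.X_Y, ih, hZ', map_smul, pow_succ' _ i,
      Module.End.mul_apply, smul_smul, ← sub_smul, geom_sum_succ (n := i + 1)]
    congr 1
    ring

/-- Multiplying the geometric sum by q - 1 gives q^(i+1) - 1, nonzero as q is not a root of unity.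
-/
theorem neg_mul_geom_sum_ne_zero {q z : ℂ} (hq : ∀ n : ℕ, 0 < n → q ^ n ≠ 1) (hz : z ≠ 0)
    (i : ℕ) : -(z * (∑ j ∈ Finset.range (i + 1), q ^ j)) ≠ 0 := by
  intro hi
  rw [neg_eq_zero, mul_eq_zero] at hi
  have := mul_geom_sum q (i + 1)
  rw [hi.resolve_left hz, mul_zero] at this
  exact hq (i + 1) i.succ_pos (sub_eq_zero.1 this.symm)

/-- The sum of the subspaces `Y^i (ker X)` is direct. -/
theorem eq_zero_of_sum_Y_pow (hq : ∀ n : ℕ, 0 < n → q ^ n ≠ 1) (hz : z ≠ 0)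
    (hZ : HasCentralCharge q z V) (m : ℕ) :
    ∀ f : ℕ → V, (∀ i, op q V .X (f i) = 0) →
      ∑ i ∈ Finset.range m, (op q V .Y ^ i) (f i) = 0 → ∀ i < m, f i = 0 := by
  induction m with
  | zero => intro f _ _ i hi; omega
  | succ m ih =>
    intro f hf h0
    have hc := fun i => neg_mul_geom_sum_ne_zero hq hz i
    -- X kills the term of degree 0 and lowers every other degree by one, so the induction
    -- hypothesis applies to nonzero multiples of the f (i + 1). The degree 0 term is then the only
    -- one left.
    rw [Finset.sum_range_succ'] at h0
    have h1 := congrArg (op q V .X) h0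
    rw [map_add, map_sum, pow_zero, Module.End.one_apply, hf, add_zero, map_zero] at h1
    have h2 := ih (fun i => (-(z * (∑ j ∈ Finset.range (i + 1), q ^ j))) • f (i + 1))
      (fun i => by rw [map_smul, hf, smul_zero])
      (by
        rw [← h1]
        refine Finset.sum_congr rfl fun i _ => ?_
        rw [X_Y_pow hZ (hf _), map_smul])
    have h3 : ∀ i < m, f (i + 1) = 0 := fun i hi => (smul_eq_zero.1 (h2 i hi)).resolve_left (hc i)
    rw [Finset.sum_eq_zero fun i hi => by rw [h3 i (Finset.mem_range.1 hi), map_zero], zero_add,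
      pow_zero, Module.End.one_apply] at h0
    rintro (_ | i) hi
    · exact h0
    · exact h3 i (by omega)

theorem Tens.exists_sum (t : Tens hq0 M (Btilde hq0 hq hp hz)) :
    ∃ (f : ℕ →₀ M), t = f.sum fun i m => Tens.mk hq0 M _ m (Btilde.v hq0 hq hp hz i) := by
  let L : (ℕ →₀ M) →ₗ[ℂ] Tens hq0 M (Btilde hq0 hq hp hz) :=
    Finsupp.lsum ℂ fun i => (Tens.mk hq0 M (Btilde hq0 hq hp hz)).flip (Btilde.v hq0 hq hp hz i)
  obtain ⟨f, hf⟩ := Tens.mk_v_mem hq0 hq hp hz (S := LinearMap.range L)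
    (fun i m => ⟨Finsupp.single i m, by simp [L]⟩) t
  exact ⟨f, hf.symm⟩

theorem Tens.phi_injective (f : M →ₗ[ℂ] V) (hf : Function.Injective f)
    (hZ : HasCentralCharge q z V) (hX : ∀ m, op q V .X (f m) = 0) :
    Function.Injective (Tens.phi hq0 hq hp hz f) := by
  refine (injective_iff_map_eq_zero _).2 fun t ht => ?_
  obtain ⟨c, rfl⟩ := Tens.exists_sum hq0 hq hp hz t
  -- The finitely supported sum is rewritten over an initial segment of ℕ, the shape needed for the
  -- directness of the sum of the Y^i (ker X).
  rw [Finsupp.sum_of_support_subset c (s := Finset.range (c.support.sup id + 1))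
    (fun i hi => Finset.mem_range.2 (Nat.lt_succ_of_le (Finset.le_sup (f := id) hi))) _
    (by simp)] at ht ⊢
  simp only [map_sum, Tens.phi_mk] at ht
  refine Finset.sum_eq_zero fun i hi => ?_
  have := eq_zero_of_sum_Y_pow hq hz hZ _ (fun i => f (c i)) (fun i => hX _) ht i
    (Finset.mem_range.1 hi)
  rw [hf (this.trans (map_zero f).symm), map_zero, LinearMap.zero_apply]

/-- X maps the image of the comparison map onto itself. If X v is in the image, then X v = X w for
some w in the image, and v - w lies in ker X, hence also in the image. Induction on the nilpotency
order of X at v finishes. -/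
theorem Tens.phi_surjective (f : M →ₗ[ℂ] V) (hZ : HasCentralCharge q z V)
    (hX : ∀ m, op q V .X (f m) = 0) (hf : ∀ v, op q V .X v = 0 → ∃ m, f m = v)
    (hnil : ∀ v : V, ∃ k : ℕ, (op q V .X ^ k) v = 0) :
    Function.Surjective (Tens.phi hq0 hq hp hz f) := by
  set Φ := Tens.phi hq0 hq hp hz f with hΦ
  have hlift : ∀ t, ∃ s, op q V .X (Φ s) = Φ t := by
    intro t
    refine Tens.mk_v_mem hq0 hq hp hz
      (S := (LinearMap.range (op q V .X ∘ₗ Φ)).comap Φ) (fun i m => ?_) t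
    have hc := neg_mul_geom_sum_ne_zero hq hz i
    -- A preimage of Y^i (f m) under X is Y^(i+1) (f m) divided by the scalar of `X_Y_pow`.
    refine ⟨(-(z * (∑ j ∈ Finset.range (i + 1), q ^ j)))⁻¹ •
      Tens.mk hq0 M _ m (Btilde.v hq0 hq hp hz (i + 1)), ?_⟩
    rw [LinearMap.comp_apply, map_smul, map_smul, hΦ, Tens.phi_mk, X_Y_pow hZ (hX m), smul_smul,
      inv_mul_cancel₀ hc, one_smul, Tens.phi_mk]
  have key : ∀ k v, (op q V .X ^ k) v = 0 → ∃ t, Φ t = v := by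
    intro k
    induction k with
    | zero => intro v hv; exact ⟨0, by rw [map_zero]; exact hv.symm⟩
    | succ k ih =>
      intro v hv
      rw [pow_succ, Module.End.mul_apply] at hv
      obtain ⟨t, ht⟩ := ih _ hv
      obtain ⟨s, hs⟩ := hlift t
      obtain ⟨m, hm⟩ := hf (v - Φ s) (by rw [map_sub, hs, ht, sub_self])
      refine ⟨Tens.mk hq0 M _ m (Btilde.v hq0 hq hp hz 0) + s, ?_⟩
      rw [map_add, hΦ, Tens.phi_mk, pow_zero, Module.End.one_apply, hm, ← hΦ, sub_add_cancel]
  intro v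
  obtain ⟨k, hk⟩ := hnil v
  exact key k v hk

variable [Module (Us q) M] [IsScalarTower ℂ (Us q) M]

/-- A subspace of `M ⊗ B̃_z` which contains all `m ⊗ v_0` and is stable under `Y` is everything. -/
theorem Tens.mem_of_Y_mem {S : Submodule ℂ (Tens hq0 M (Btilde hq0 hq hp hz))}
    (h0 : ∀ m, Tens.mk hq0 M _ m (Btilde.v hq0 hq hp hz 0) ∈ S)
    (hY : ∀ t ∈ S, op q _ .Y t ∈ S) (t : Tens hq0 M (Btilde hq0 hq hp hz)) : t ∈ S := by
  refine Tens.mk_v_mem hq0 hq hp hz (fun i => ?_) t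
  induction i with
  | zero => exact h0
  | succ i ih =>
    intro m
    have := hY _ (ih m)
    rwa [op_apply, Tens.XYZ_mk hq0 rfl, Btilde.Y_v] at this

/-- The vectors at which the map commutes with a given generator form a subspace. The relation of
that generator with Y shows that it is stable under Y, so checking the vectors m ⊗ v_0 suffices. The
order matters: X uses Z, and E uses X, since XY and EY produce these terms. -/
theorem Tens.phi_gen_smul (f : M →ₗ[ℂ] V) (hZ : HasCentralCharge q z V)
    (hX : ∀ m, op q V .X (f m) = 0)
    (hE : ∀ m, f (Us.gen q .E • m) = vacOp q p z V .E (f m))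
    (hF : ∀ m, f (Us.gen q .F • m) = vacOp q p z V .F (f m))
    (hK : ∀ m, f (Us.gen q .K • m) = vacOp q p z V .K (f m))
    (hKi : ∀ m, f (Us.gen q .Ki • m) = vacOp q p z V .Ki (f m)) (g : SGen)
    (t : Tens hq0 M (Btilde hq0 hq hp hz)) :
    Tens.phi hq0 hq hp hz f (Us.gen q g • t) = Us.gen q g • Tens.phi hq0 hq hp hz f t := by
  have hp0 : p ≠ 0 := by rintro rfl; simp at hp; exact hq0 hp.symm
  have h2 : q ^ 2 - 1 ≠ 0 := sub_ne_zero.2 (hq 2 two_pos)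
  have h3 : q + 1 ≠ 0 := by
    intro h; apply h2; linear_combination (q - 1) * h
  have hV := op_act q V
  have hW := op_act q (Tens hq0 M (Btilde hq0 hq hp hz))
  have phi0 : ∀ m, Tens.phi hq0 hq hp hz f (Tens.mk hq0 M _ m (Btilde.v hq0 hq hp hz 0)) = f m :=
    fun m => by rw [Tens.phi_mk, pow_zero, Module.End.one_apply]
  -- The index is left as 0 + 2 to match the form in which `Btilde.F_v` produces it.
  have phi2 : ∀ m, Tens.phi hq0 hq hp hz f (Tens.mk hq0 M _ m (Btilde.v hq0 hq hp hz (0 + 2))) =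
      op q V .Y (op q V .Y (f m)) :=
    fun m => by rw [Tens.phi_mk, zero_add, pow_two, Module.End.mul_apply]
  have hYv : ∀ t, Tens.phi hq0 hq hp hz f (op q _ .Y t) =
      op q V .Y (Tens.phi hq0 hq hp hz f t) := by
    refine Tens.mk_v_mem hq0 hq hp hz (S := LinearMap.eqLocus
      (Tens.phi hq0 hq hp hz f ∘ₗ op q _ .Y) (op q V .Y ∘ₗ Tens.phi hq0 hq hp hz f))
      fun i m => ?_
    rw [LinearMap.mem_eqLocus, LinearMap.comp_apply, LinearMap.comp_apply, op_apply,
      Tens.XYZ_mk hq0 rfl, Btilde.Y_v, Tens.phi_mk, Tens.phi_mk, pow_succ',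
      Module.End.mul_apply]
  generalize hΦ : Tens.phi hq0 hq hp hz f = Φ at *
  have key : ∀ g, (∀ m, Φ (Us.gen q g • (Tens.mk hq0 _ _ m (Btilde.v hq0 hq hp hz 0))) =
      op q V g (f m)) → (∀ t, Φ (op q _ g t) = op q V g (Φ t) →
        Φ (op q _ g (op q _ .Y t)) = op q V g (Φ (op q _ .Y t))) →
      ∀ t, Φ (op q _ g t) = op q V g (Φ t) := by
    intro g h0 hY
    refine Tens.mem_of_Y_mem hq0 hq hp hz
      (S := LinearMap.eqLocus (Φ ∘ₗ op q _ g) (op q V g ∘ₗ Φ)) (fun m => ?_) hY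
    rw [LinearMap.mem_eqLocus, LinearMap.comp_apply, LinearMap.comp_apply, op_apply, h0, phi0]
  have hZv : ∀ t, Φ (op q _ .Z t) = op q V .Z (Φ t) := by
    apply key
    · intro m
      rw [Tens.XYZ_mk hq0 rfl, Btilde.Z_v, map_smul, map_smul, phi0]
      exact (hZ _).symm
    · intro t ht
      rw [hW.Z_central, hYv, ht, hYv, hV.Z_central]
  have hXv : ∀ t, Φ (op q _ .X t) = op q V .X (Φ t) := by
    apply key
    · intro m
      rw [Tens.XYZ_mk hq0 rfl, Btilde.X_v_zero, map_zero, map_zero, hX]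
    · intro t ht
      rw [hW.X_Y, hYv, hV.X_Y, map_sub, map_smul, hYv, ht, hZv]
  have hKv : ∀ t, Φ (op q _ .K t) = op q V .K (Φ t) := by
    apply key
    · intro m
      rw [Tens.K_mk, Btilde.K_v, map_smul, map_smul, phi0, hK]
      simp [vacOp, smul_smul, hp0]
    · intro t ht
      rw [hW.K_Y, hYv, hV.K_Y, map_smul, hYv, ht]
  -- No induction is needed here: K⁻¹ is a two-sided inverse of K on both sides.
  have hKiv : ∀ t, Φ (op q _ .Ki t) = op q V .Ki (Φ t) := by
    intro t
    rw [← hV.Ki_K (Φ _), ← hKv, hW.K_Ki]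
  have hEv : ∀ t, Φ (op q _ .E t) = op q V .E (Φ t) := by
    apply key
    · intro m
      rw [Tens.E_mk, Btilde.E_v_zero, Btilde.K_v, map_zero, zero_add, map_smul, map_smul, phi0,
        hE]
      simp [vacOp, smul_smul, hp0]
    · intro t ht
      rw [hW.E_Y, hYv, hV.E_Y, map_add, map_smul, hYv, ht, hXv]
  have hFv : ∀ t, Φ (op q _ .F t) = op q V .F (Φ t) := by
    apply key
    · intro m
      rw [Tens.F_mk, Btilde.F_v, map_add, map_smul, map_smul, phi2, phi0, hF, hKi]
      simp only [vacOp, LinearMap.sub_apply, LinearMap.smul_apply, LinearMap.comp_apply, map_smul,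
        smul_smul]
      match_scalars <;> field_simp
      ring
    · intro t ht
      rw [hW.F_Y, hYv, ht, hYv, hV.F_Y]
  cases g with
  | E => exact hEv t
  | F => exact hFv t
  | K => exact hKv t
  | Ki => exact hKiv t
  | X => exact hXv t
  | Y => exact hYv t
  | Z => exact hZv t

end Phi

/-! ### Modules in category `O` -/

section O

variable {q p z : ℂ} {V : Type*} [AddCommGroup V] [Module ℂ V] [Module (Us q) V]
  [IsScalarTower ℂ (Us q) V]

/-- On a module in category `O` the operator `X` is locally nilpotent. -/
theorem InO.exists_X_pow_eq_zero (hq0 : q ≠ 0) (hq : ∀ n : ℕ, 0 < n → q ^ n ≠ 1)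
    (hV : InO q V) (v : V) : ∃ k : ℕ, (op q V .X ^ k) v = 0 := by
  have hK := (op_act q V).K_X
  have hweight : ∀ l : ℂˣ, ∀ w : V, op q V .K w = (l : ℂ) • w →
      ∃ k : ℕ, (op q V .X ^ k) w = 0 := by
    intro l w hw
    -- If no X^k w vanished, these would be eigenvectors of K for the pairwise distinct eigenvalues
    -- q^k l, hence linearly independent. They all lie in the finite-dimensional space generated
    -- from w by E and X, a contradiction.
    by_contra! hne
    have heig : ∀ k : ℕ, op q V .K ((op q V .X ^ k) w) =
        (q ^ k * (l : ℂ)) • (op q V .X ^ k) w := by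
      intro k
      induction k with
      | zero => simpa using hw
      | succ k ih =>
        rw [pow_succ', Module.End.mul_apply, hK, ih, map_smul, smul_smul, pow_succ', mul_assoc]
    have hinj : Function.Injective fun k : ℕ => q ^ k * (l : ℂ) := by
      have hlt : ∀ i j : ℕ, i < j → q ^ i * (l : ℂ) ≠ q ^ j * (l : ℂ) := by
        intro i j hij h
        have h1 := mul_right_cancel₀ l.ne_zero h
        obtain ⟨d, rfl⟩ := Nat.exists_eq_add_of_lt hij
        rw [add_assoc, pow_add] at h1
        exact hq (d + 1) d.succ_pos
          (mul_left_cancel₀ (pow_ne_zero i hq0) (h1.symm.trans (mul_one _).symm))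
      intro i j h
      rcases lt_trichotomy i j with hij | hij | hij
      · exact absurd h (hlt i j hij)
      · exact hij
      · exact absurd h.symm (hlt j i hij)
    have hli : LinearIndependent ℂ fun k : ℕ => (op q V .X ^ k) w :=
      Module.End.eigenvectors_linearIndependent' (op q V .K) _ hinj _
        fun k => ⟨Module.End.mem_eigenspace_iff.2 (heig k), hne k⟩
    have hfin := hV.locallyFinite w
    set W := Submodule.span ℂ ((fun u : Us q => u • w) ''
      (Algebra.adjoin ℂ {Us.gen q .E, Us.gen q .X} : Set (Us q))) with hW
    have hmem : ∀ k : ℕ, (op q V .X ^ k) w ∈ W := by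
      intro k
      refine Submodule.subset_span ⟨Us.gen q .X ^ k, pow_mem (Algebra.subset_adjoin (by simp)) k,
        ?_⟩
      change _ = (Algebra.lsmul ℂ ℂ V (Us.gen q .X) ^ k) w
      rw [← map_pow]
      rfl
    have hli' : LinearIndependent ℂ fun k : ℕ => (⟨_, hmem k⟩ : W) :=
      LinearIndependent.of_comp W.subtype hli
    exact not_finite_iff_infinite.2 (inferInstanceAs (Infinite ℕ)) hli'.finite
  have htop := hV.weight.submodule_iSup_eq_top
  have hv : v ∈ ⨆ l : ℂˣ, Module.End.eigenspace (Algebra.lsmul ℂ ℂ V (Us.gen q .K)) (l : ℂ) := by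
    rw [htop]; trivial
  induction hv using Submodule.iSup_induction' with
  | mem l w hw => exact hweight l w (Module.End.mem_eigenspace_iff.1 hw)
  | zero => exact ⟨0, map_zero _⟩
  | add x y _ _ hx hy =>
    obtain ⟨i, hi⟩ := hx
    obtain ⟨j, hj⟩ := hy
    refine ⟨i + j, ?_⟩
    rw [map_add, add_comm i j, pow_add, Module.End.mul_apply, hi, map_zero, zero_add,
      ← pow_add, add_comm j i, pow_add, Module.End.mul_apply, hj, map_zero]

/-- The kernel of `X` is spanned by weight vectors. -/
theorem InO.exists_weights_of_X_eq_zero (hq0 : q ≠ 0) (hV : InO q V) {v : V}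
    (hv : op q V .X v = 0) : ∃ m : ℂˣ →₀ V, (m.sum fun _ w => w) = v ∧
      ∀ l, op q V .K (m l) = (l : ℂ) • m l ∧ op q V .X (m l) = 0 := by
  have hv' : v ∈ ⨆ l : ℂˣ, Module.End.eigenspace (op q V .K) (l : ℂ) := by
    have htop := hV.weight.submodule_iSup_eq_top
    change (⨆ l : ℂˣ, Module.End.eigenspace (op q V .K) (l : ℂ)) = ⊤ at htop
    rw [htop]; trivial
  obtain ⟨m, hm, hsum⟩ := (Submodule.mem_iSup_iff_exists_finsupp _ _).1 hv'
  refine ⟨m, hsum, fun l => ⟨Module.End.mem_eigenspace_iff.1 (hm l), ?_⟩⟩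
  -- X carries weight l to weight ql. The images under X of the components of v thus lie in
  -- independent eigenspaces and sum to X v = 0, so each of them is zero.
  have hinj : Function.Injective fun l : ℂˣ => q * (l : ℂ) := fun a b h =>
    Units.ext (mul_left_cancel₀ hq0 h)
  have hind := (Module.End.eigenspaces_iSupIndep (op q V .K)).comp hinj
  rw [iSupIndep_iff_finsetSum_eq_zero_imp_eq_zero] at hind
  by_cases hl : l ∈ m.support
  · refine hind m.support (fun l => op q V .X (m l)) (fun i _ => ?_) ?_ l hl
    · refine Module.End.mem_eigenspace_iff.2 ?_
      rw [(op_act q V).K_X, Module.End.mem_eigenspace_iff.1 (hm i), map_smul, smul_smul]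
    · rw [← map_sum, ← hv, ← hsum]
      rfl
  · rw [Finsupp.notMem_support_iff.1 hl, map_zero]

end O

/-! ### The kernel of X in category O, and the isomorphism -/

section VacO

variable {q p z : ℂ} {V : Type*} [AddCommGroup V] [Module ℂ V] [Module (Us q) V]
  [IsScalarTower ℂ (Us q) V]
  (hq0 : q ≠ 0) (hq1 : q + 1 ≠ 0) (hp : p ^ 2 = q) (hq2 : q ^ 2 - 1 ≠ 0)
  (hz : z ≠ 0) (hZ : HasCentralCharge q z V)

theorem Vac.isInternal_weight (hV : InO q V) :
    DirectSum.IsInternal fun l : ℂˣ => Module.End.eigenspace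
      (Algebra.lsmul ℂ ℂ (Vac q p z V hq0 hq1 hp hq2 hz hZ) (Ul.gen q .K)) (l : ℂ) := by
  have hp0 : p ≠ 0 := by rintro rfl; simp at hp; exact hq0 hp.symm
  refine DirectSum.isInternal_submodule_of_iSupIndep_of_iSup_eq_top
    ((Module.End.eigenspaces_iSupIndep _).comp Units.val_injective) (eq_top_iff.2 fun n _ => ?_)
  obtain ⟨m, hsum, hm⟩ := InO.exists_weights_of_X_eq_zero hq0 hV
    (Vac.X_incl hq0 hq1 hp hq2 hz hZ n)
  choose n' hn' using fun l => Vac.exists_incl hq0 hq1 hp hq2 hz hZ (hm l).2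
  have hn : n = ∑ l ∈ m.support, n' l := by
    apply Vac.incl_injective hq0 hq1 hp hq2 hz hZ
    rw [map_sum, ← hsum]
    exact Finset.sum_congr rfl fun l _ => (hn' l).symm
  rw [hn]
  -- K acts on N as pK, so weight l in V becomes weight pl in N.
  refine Submodule.sum_mem _ fun l _ => Submodule.mem_iSup_of_mem (Units.mk0 p hp0 * l) ?_
  rw [Module.End.mem_eigenspace_iff]
  apply Vac.incl_injective hq0 hq1 hp hq2 hz hZ
  rw [Algebra.lsmul_coe, Vac.incl_gen_smul, map_smul, hn']
  change p • op q V .K (m l) = _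
  rw [(hm l).1, smul_smul]
  rfl

/-- E acts on N as pE, so each element of the subalgebra generated by E acts on N as some element of
the positive part of U_q(s) does on V. The orbit of n therefore embeds into a finite-dimensional
one. -/
theorem Vac.finiteDimensional_span_E (hV : InO q V) (n : Vac q p z V hq0 hq1 hp hq2 hz hZ) :
    FiniteDimensional ℂ (Submodule.span ℂ
      ((fun u : Ul q => u • n) '' (Algebra.adjoin ℂ {Ul.gen q .E} : Set (Ul q)))) := by
  have hfin := hV.locallyFinite (Vac.incl hq0 hq1 hp hq2 hz hZ n)
  set W := Submodule.span ℂ ((fun u : Us q => u • Vac.incl hq0 hq1 hp hq2 hz hZ n) ''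
      (Algebra.adjoin ℂ {Us.gen q .E, Us.gen q .X} : Set (Us q))) with hW
  have key : ∀ u ∈ Algebra.adjoin ℂ {Ul.gen q .E},
      ∃ w ∈ Algebra.adjoin ℂ {Us.gen q .E, Us.gen q .X},
        ∀ n, Vac.incl hq0 hq1 hp hq2 hz hZ (u • n) = w • Vac.incl hq0 hq1 hp hq2 hz hZ n := by
    intro u hu
    induction hu using Algebra.adjoin_induction with
    | mem x hx =>
      obtain rfl := hx
      refine ⟨p • Us.gen q .E, Subalgebra.smul_mem _ (Algebra.subset_adjoin (by simp)) p,
        fun n => ?_⟩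
      rw [Vac.incl_gen_smul, smul_assoc]
      rfl
    | algebraMap r =>
      refine ⟨algebraMap ℂ _ r, Subalgebra.algebraMap_mem _ r, fun n => ?_⟩
      rw [algebraMap_smul, algebraMap_smul, map_smul]
    | add x y _ _ hx hy =>
      obtain ⟨a, ha, ha'⟩ := hx
      obtain ⟨b, hb, hb'⟩ := hy
      exact ⟨a + b, add_mem ha hb, fun n => by rw [add_smul, map_add, ha', hb', add_smul]⟩
    | mul x y _ _ hx hy =>
      obtain ⟨a, ha, ha'⟩ := hx
      obtain ⟨b, hb, hb'⟩ := hy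
      exact ⟨a * b, mul_mem ha hb, fun n => by rw [mul_smul, ha', hb', mul_smul]⟩
  have hle : Submodule.span ℂ
      ((fun u : Ul q => u • n) '' (Algebra.adjoin ℂ {Ul.gen q .E} : Set (Ul q))) ≤
      W.comap (Vac.incl hq0 hq1 hp hq2 hz hZ) := by
    refine Submodule.span_le.2 ?_
    rintro _ ⟨u, hu, rfl⟩
    obtain ⟨w, hw, hw'⟩ := key u hu
    exact Submodule.subset_span ⟨w, hw, (hw' n).symm⟩
  have : FiniteDimensional ℂ (W.comap (Vac.incl hq0 hq1 hp hq2 hz hZ)) := by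
    refine Module.Finite.of_injective ((Vac.incl hq0 hq1 hp hq2 hz hZ).restrict
      (p := W.comap (Vac.incl hq0 hq1 hp hq2 hz hZ)) (q := W) fun x hx => hx) ?_
    intro a b h
    have h' : Vac.incl hq0 hq1 hp hq2 hz hZ a = Vac.incl hq0 hq1 hp hq2 hz hZ b :=
      congrArg (fun w : W => (w : V)) h
    exact Subtype.ext (Vac.incl_injective hq0 hq1 hp hq2 hz hZ h')
  exact Submodule.finiteDimensional_of_le hle

variable (hq : ∀ n : ℕ, 0 < n → q ^ n ≠ 1)

/-- The inclusion of the kernel of `X`, as a map on its inflation. -/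
def Vac.inflIncl : Infl q (Vac q p z V hq0 hq1 hp hq2 hz hZ) →ₗ[ℂ] V :=
  Vac.incl hq0 hq1 hp hq2 hz hZ ∘ₗ (Infl.out q _).toLinearMap

theorem Vac.inflIncl_gen_smul {g : SGen} {g' : LGen} (h : projFun q g = Ul.gen q g')
    (n : Infl q (Vac q p z V hq0 hq1 hp hq2 hz hZ)) :
    Vac.inflIncl hq0 hq1 hp hq2 hz hZ (Us.gen q g • n) =
      vacOp q p z V g' (Vac.inflIncl hq0 hq1 hp hq2 hz hZ n) := by
  change Vac.incl hq0 hq1 hp hq2 hz hZ (Infl.out q _ (Us.gen q g • n)) = _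
  rw [Infl.out_gen_smul, h, Vac.incl_gen_smul]
  rfl

/-- A module in `O` with central charge `z` is the tensor product of the kernel of `X`
with `B̃_z`. -/
theorem Vac.bijective_phi (hV : InO q V) :
    Function.Bijective (Tens.phi hq0 hq hp hz (Vac.inflIncl hq0 hq1 hp hq2 hz hZ)) :=
  ⟨Tens.phi_injective hq0 hq hp hz _ (Vac.incl_injective hq0 hq1 hp hq2 hz hZ) hZ
      (Vac.X_incl hq0 hq1 hp hq2 hz hZ),
    Tens.phi_surjective hq0 hq hp hz _ hZ
      (Vac.X_incl hq0 hq1 hp hq2 hz hZ) (fun _ => Vac.exists_incl hq0 hq1 hp hq2 hz hZ)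
      (hV.exists_X_pow_eq_zero hq0 hq)⟩

/-- The isomorphism `Ñ ⊗ B̃_z ≃ V` of `U_q(s)`-modules, `N` the kernel of `X`. -/
def Vac.equiv (hV : InO q V) :
    Tens hq0 (Infl q (Vac q p z V hq0 hq1 hp hq2 hz hZ)) (Btilde hq0 hq hp hz) ≃ₗ[Us q] V :=
  LinearEquiv.ofBijective
    { toFun := Tens.phi hq0 hq hp hz (Vac.inflIncl hq0 hq1 hp hq2 hz hZ)
      map_add' := map_add _
      map_smul' := Us.map_smul_of_gen
        (Tens.phi hq0 hq hp hz (Vac.inflIncl hq0 hq1 hp hq2 hz hZ)) (Tens.phi_gen_smul hq0 hq hp hz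
        (Vac.inflIncl hq0 hq1 hp hq2 hz hZ) hZ
        (Vac.X_incl hq0 hq1 hp hq2 hz hZ)
        (Vac.inflIncl_gen_smul hq0 hq1 hp hq2 hz hZ rfl)
        (Vac.inflIncl_gen_smul hq0 hq1 hp hq2 hz hZ rfl)
        (Vac.inflIncl_gen_smul hq0 hq1 hp hq2 hz hZ rfl)
        (Vac.inflIncl_gen_smul hq0 hq1 hp hq2 hz hZ rfl)) }
    (Vac.bijective_phi hq0 hq1 hp hq2 hz hZ hq hV)

end VacO

/-- If `Ñ ⊗ B̃_z` is finitely generated, then so is `N`. -/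
theorem finite_of_finite_tens {q p z : ℂ} (hq0 : q ≠ 0) (hq : ∀ n : ℕ, 0 < n → q ^ n ≠ 1)
    (hp : p ^ 2 = q) (hz : z ≠ 0) {N : Type*} [AddCommGroup N] [Module ℂ N] [Module (Ul q) N]
    [IsScalarTower ℂ (Ul q) N]
    (h : Module.Finite (Us q) (Tens hq0 (Infl q N) (Btilde hq0 hq hp hz))) :
    Module.Finite (Ul q) N := by
  classical
  obtain ⟨s, hs⟩ := h.fg_top
  choose c hc using Tens.exists_finite_mem_spanLeft hq0 (M := Infl q N)
    (B := Btilde hq0 hq hp hz)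
  -- The left factors occurring in a finite generating set of the tensor product are collected; they
  -- will generate N.
  let t : Finset N := s.biUnion c
  let S : Submodule (Ul q) N := Submodule.span (Ul q) (t : Set N)
  let S' : Submodule ℂ (Infl q N) := (S.restrictScalars ℂ).comap (Infl.out q N).toLinearMap
  have hS' : ∀ g, ∀ m ∈ S', Us.gen q g • m ∈ S' := by
    intro g m hm
    change Infl.out q N (Us.gen q g • m) ∈ S
    rw [Infl.out_gen_smul]
    exact S.smul_mem _ hm
  have htS : ∀ x ∈ s, x ∈ Tens.spanLeft hq0 (Infl q N) (Btilde hq0 hq hp hz) S' := by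
    intro x hx
    refine hc x S' fun m hm => ?_
    change (m : N) ∈ S
    exact Submodule.subset_span (Finset.mem_coe.2 (Finset.mem_biUnion.2 ⟨x, hx, hm⟩))
  -- S ⊗ B is a U_q(s)-submodule containing the generators, hence everything. Taking the coefficient
  -- of v_0 in n ⊗ v_0 then puts an arbitrary n in S.
  let W : Submodule (Us q) (Tens hq0 (Infl q N) (Btilde hq0 hq hp hz)) :=
    { Tens.spanLeft hq0 (Infl q N) (Btilde hq0 hq hp hz) S' with
      smul_mem' := fun u m hm => Us.smul_mem_of_gen _
        (Tens.gen_smul_mem_spanLeft hq0 S' hS') u m hm }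
  have hW : W = ⊤ := by
    rw [eq_top_iff, ← hs]
    exact Submodule.span_le.2 htS
  refine ⟨⟨t, eq_top_iff.2 fun n _ => ?_⟩⟩
  have hn : Tens.mk hq0 (Infl q N) _ n (Btilde.v hq0 hq hp hz 0) ∈ W := by rw [hW]; trivial
  exact Tens.mem_of_mk_mem_spanLeft hq0 S' (Finsupp.lapply 0 : (ℕ →₀ ℂ) →ₗ[ℂ] ℂ)
    (by simp [Btilde.v, bvec]) hn

end QSchr

end

theorem mainTheorem4 (q p z : ℂ) (hq0 : q ≠ 0) (hq : ∀ n : ℕ, 0 < n → q ^ n ≠ 1)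
    (hp : p ^ 2 = q) (hz : z ≠ 0)
    (V : Type u) [AddCommGroup V] [Module ℂ V] [Module (QSchr.Us q) V]
    [IsScalarTower ℂ (QSchr.Us q) V]
    (hV : QSchr.InOz q z V) (hZ : QSchr.HasCentralCharge q z V) :
    ∃ (N : Type u) (_ : AddCommGroup N) (_ : Module ℂ N) (_ : Module (QSchr.Ul q) N)
      (_ : IsScalarTower ℂ (QSchr.Ul q) N),
      QSchr.InOsl2 q N ∧
      Nonempty (V ≃ₗ[QSchr.Us q]
        QSchr.Tens hq0 (QSchr.Infl q N) (QSchr.Btilde hq0 hq hp hz)) := by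
  have hq2 : q ^ 2 - 1 ≠ 0 := sub_ne_zero.2 (hq 2 two_pos)
  have hq1 : q + 1 ≠ 0 := by
    intro h; apply hq2; linear_combination (q - 1) * h
  have e := QSchr.Vac.equiv hq0 hq1 hp hq2 hz hZ hq hV.1
  have hfin := hV.1.finite
  exact ⟨QSchr.Vac q p z V hq0 hq1 hp hq2 hz hZ, inferInstance, inferInstance, inferInstance,
    inferInstance,
    { finite := QSchr.finite_of_finite_tens hq0 hq hp hz (Module.Finite.equiv e.symm)
      weight := QSchr.Vac.isInternal_weight hq0 hq1 hp hq2 hz hZ hV.1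
      locallyFinite := QSchr.Vac.finiteDimensional_span_E hq0 hq1 hp hq2 hz hZ hV.1 },
    ⟨e.symm⟩⟩
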